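/- Let $G$ be a discrete group with unit $e$ and let $\mathcal B=\{B_t\}_{t\in G}$ be a Fell bundle over $G$. Let $C^*(\mathcal B)$ be its full cross-sectional $C^*$-algebra, i.e. the completion of the $*$-algebra $C_c(\mathcal B)=\bigoplus_{t\in G}B_t$ of finitely supported sections in its largest $C^*$-seminorm. Let $\ell^2(\mathcal B)$ be the right Hilbert $B_e$-module of all sections $\xi=(\xi_t)_{t\in G}$ for which $\sum_t\xi_t^*\xi_t$ converges unconditionally in norm in $B_e$, with inner product $\langle\xi,\eta\rangle=\sum_t\xi_t^*\eta_t$, and let $C^*_r(\mathcal B)$, the reduced cross-sectional $C^*$-algebra, be the closed $*$-subalgebra of the $C^*$-algebra of adjointable operators on $\ell^2(\mathcal B)$ generated by the left multiplication operators $\xi\mapsto b_t\xi$, where $(b_t\xi)_s=b_t\,\xi_{t^{-1}s}$ for $t,s\in G$ and $b_t\in B_t$. Let $\Lambda\colon C^*(\mathcal B)\to C^*_r(\mathcal B)$ be the $*$-homomorphism that maps each $b_t\in B_t$ to the operator of left multiplication by $b_t$. Let $\lambda$ be the left regular representation of $G$ on $\ell^2(G)$. Let $\Pi$ be any representation of $C^*(\mathcal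 B)$ on a Hilbert space $H$ (a $*$-homomorphism to the algebra $\mathscr B(H)$ of bounded operators on $H$, possibly degenerate), and let $\Pi\otimes\Lambda$ be the representation of $C^*(\mathcal B)$ on the Hilbert space tensor product $H\otimes\ell^2(G)$ determined by $$(\Pi\otimes\Lambda)(b_t)=\Pi(b_t)\otimes\lambda_t\qquad(t\in G,\ b_t\in B_t).$$ Then there exists a representation $\Pi'$ of $C^*_r(\mathcal B)$ on $H\otimes\ell^2(G)$ such that $$\Pi'\circ\Lambda=\Pi\otimes\Lambda .$$ If moreover $\Pi$ is faithful (injective) on $B_e$, then $\Pi'$ is faithful on $C^*_r(\mathcal B)$. -/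

import Mathlib

/-- A C⋆-seminorm on a complex `*`-algebra. -/
structure CStarSeminorm (A : Type*) [NonUnitalRing A] [StarRing A] [Module ℂ A] extends
    Seminorm ℂ A where
  mul_le' : ∀ a b : A, toFun (a * b) ≤ toFun a * toFun b
  star_mul_self' : ∀ a : A, toFun (star a * a) = toFun a * toFun a

namespace CStarSeminorm

variable {A : Type*} [NonUnitalRing A] [StarRing A] [Module ℂ A]

/-- A copy of the `*`-algebra `A`, which carries the topology of the seminorm `p`. -/
@[nolint unusedArguments]
def Space (_p : CStarSeminorm A) : Type _ := A

variable (p : CStarSeminorm A)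

instance : NonUnitalRing p.Space := inferInstanceAs (NonUnitalRing A)
instance : StarRing p.Space := inferInstanceAs (StarRing A)
instance : Module ℂ p.Space := inferInstanceAs (Module ℂ A)
instance [IsScalarTower ℂ A A] : IsScalarTower ℂ p.Space p.Space :=
  inferInstanceAs (IsScalarTower ℂ A A)
instance [SMulCommClass ℂ A A] : SMulCommClass ℂ p.Space p.Space :=
  inferInstanceAs (SMulCommClass ℂ A A)
instance [StarModule ℂ A] : StarModule ℂ p.Space := inferInstanceAs (StarModule ℂ A)

noncomputable instance : NonUnitalSeminormedRing p.Space :=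
  { (AddGroupSeminorm.toSeminormedAddCommGroup p.toAddGroupSeminorm :
      SeminormedAddCommGroup p.Space), (inferInstance : NonUnitalRing p.Space) with
    norm_mul_le := p.mul_le' }

lemma Space.norm_def (a : p.Space) : ‖a‖ = p.toSeminorm (a : A) := rfl

noncomputable instance : NormedSpace ℂ p.Space where
  norm_smul_le c a := le_of_eq (map_smul_eq_mul p.toSeminorm c a)

lemma Space.norm_star_mul_self (a : p.Space) : ‖star a * a‖ = ‖a‖ * ‖a‖ := p.star_mul_self' a

lemma Space.norm_star_le (a : p.Space) : ‖a‖ ≤ ‖star a‖ := by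
  by_contra! h
  have h1 : ‖a‖ * ‖a‖ ≤ ‖star a‖ * ‖a‖ := by
    rw [← Space.norm_star_mul_self]; exact norm_mul_le _ _
  nlinarith [norm_nonneg (star a), norm_nonneg a]

lemma Space.norm_star (a : p.Space) : ‖star a‖ = ‖a‖ :=
  le_antisymm (by simpa using Space.norm_star_le p (star a)) (Space.norm_star_le p a)

noncomputable instance : NormedStarGroup p.Space where
  norm_star_le a := (Space.norm_star p a).le

/-- The Hausdorff completion of `A` with respect to the C⋆-seminorm `p`. -/
def Completion : Type _ := UniformSpace.Completion p.Space

namespace Completion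

open UniformSpace

noncomputable instance : NormedAddCommGroup p.Completion :=
  inferInstanceAs (NormedAddCommGroup (UniformSpace.Completion p.Space))
noncomputable instance : NormedSpace ℂ p.Completion :=
  inferInstanceAs (NormedSpace ℂ (UniformSpace.Completion p.Space))
instance : CompleteSpace p.Completion :=
  inferInstanceAs (CompleteSpace (UniformSpace.Completion p.Space))

/-- The canonical map to the completion. -/
noncomputable def of : p.Space →ₗᵢ[ℂ] p.Completion :=
  (UniformSpace.Completion.toComplₗᵢ : p.Space →ₗᵢ[ℂ] UniformSpace.Completion p.Space)

lemma denseRange_of : DenseRange (of p) := UniformSpace.Completion.denseRange_coe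

lemma isDenseInducing_of : IsDenseInducing (of p) := UniformSpace.Completion.isDenseInducing_coe

lemma continuous_of : Continuous (of p) := (of p).continuous

noncomputable instance : Mul p.Completion :=
  ⟨fun x y ↦ ((isDenseInducing_of p).prodMap (isDenseInducing_of p)).extend
    (fun q : p.Space × p.Space ↦ of p (q.1 * q.2)) (x, y)⟩

noncomputable instance : Star p.Completion :=
  ⟨(isDenseInducing_of p).extend (fun a ↦ of p (star a))⟩

lemma of_mul (a b : p.Space) : of p (a * b) = of p a * of p b :=
  (((isDenseInducing_of p).prodMap (isDenseInducing_of p)).extend_eq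
    ((continuous_of p).comp (@continuous_mul p.Space _ _ _)) (a, b)).symm

lemma of_star (a : p.Space) : of p (star a) = star (of p a) :=
  ((isDenseInducing_of p).extend_eq ((continuous_of p).comp continuous_star) a).symm

instance : ContinuousMul p.Completion where
  continuous_mul := by
    let m := (AddMonoidHom.mul : p.Space →+ p.Space →+ p.Space).compr₂
      (of p).toLinearMap.toAddMonoidHom
    have : Continuous fun q : p.Space × p.Space => m q.1 q.2 :=
      (continuous_of p).comp continuous_mul
    have di : IsDenseInducing (UniformSpace.Completion.toCompl :
      p.Space → UniformSpace.Completion p.Space) := UniformSpace.Completion.isDenseInducing_coe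
    exact (di.extend_Z_bilin di this :)

instance : ContinuousStar p.Completion where
  continuous_star := by
    have h : UniformContinuous (fun a : p.Space ↦ of p (star a)) :=
      (of p).isometry.uniformContinuous.comp
        (AddMonoidHomClass.isometry_of_norm (starAddEquiv : p.Space ≃+ p.Space)
          (fun a ↦ norm_star a)).uniformContinuous
    exact uniformContinuous_uniformly_extend
      (UniformSpace.Completion.isUniformInducing_coe p.Space) (denseRange_of p) h |>.continuous

@[elab_as_elim]
lemma ind {P : p.Completion → Prop} (x : p.Completion) (hp : IsClosed {x | P x})
    (h : ∀ a, P (of p a)) : P x := UniformSpace.Completion.induction_on x hp h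

@[elab_as_elim]
lemma ind₂ {P : p.Completion → p.Completion → Prop} (x y : p.Completion)
    (hp : IsClosed {x : p.Completion × p.Completion | P x.1 x.2})
    (h : ∀ a b, P (of p a) (of p b)) : P x y := UniformSpace.Completion.induction_on₂ x y hp h

@[elab_as_elim]
lemma ind₃ {P : p.Completion → p.Completion → p.Completion → Prop} (x y z : p.Completion)
    (hp : IsClosed {x : p.Completion × p.Completion × p.Completion | P x.1 x.2.1 x.2.2})
    (h : ∀ a b c, P (of p a) (of p b) (of p c)) : P x y z :=
  UniformSpace.Completion.induction_on₃ x y z hp h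

noncomputable instance : NonUnitalNormedRing p.Completion :=
  { (inferInstance : NormedAddCommGroup p.Completion), (inferInstance : Mul p.Completion) with
    zero_mul x := ind p x (isClosed_eq (by fun_prop) (by fun_prop)) fun a => by
      rw [← map_zero (of p), ← of_mul, zero_mul]
    mul_zero x := ind p x (isClosed_eq (by fun_prop) (by fun_prop)) fun a => by
      rw [← map_zero (of p), ← of_mul, mul_zero]
    mul_assoc x y z := ind₃ p x y z (isClosed_eq (by fun_prop) (by fun_prop)) fun a b c => by
      simp only [← of_mul, mul_assoc]
    left_distrib x y z := ind₃ p x y z (isClosed_eq (by fun_prop) (by fun_prop)) fun a b c => by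
      simp only [← of_mul, ← map_add, mul_add]
    right_distrib x y z := ind₃ p x y z (isClosed_eq (by fun_prop) (by fun_prop)) fun a b c => by
      simp only [← of_mul, ← map_add, add_mul]
    norm_mul_le x y := ind₂ p x y (isClosed_le (by fun_prop) (by fun_prop)) fun a b => by
      simp only [← of_mul, (of p).norm_map]
      exact norm_mul_le a b }

noncomputable instance : StarRing p.Completion where
  star_involutive x := ind p x (isClosed_eq (by fun_prop) (by fun_prop)) fun a => by
    simp only [← of_star, star_star]
  star_mul x y := ind₂ p x y (isClosed_eq (by fun_prop) (by fun_prop)) fun a b => by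
    simp only [← of_mul, ← of_star, star_mul]
  star_add x y := ind₂ p x y (isClosed_eq (by fun_prop) (by fun_prop)) fun a b => by
    simp only [← map_add, ← of_star, star_add]

instance : CStarRing p.Completion where
  norm_mul_self_le x := ind p x (isClosed_le (by fun_prop) (by fun_prop)) fun a => by
    simp only [← of_mul, ← of_star, (of p).norm_map, Space.norm_star_mul_self, le_refl]

instance [IsScalarTower ℂ A A] : IsScalarTower ℂ p.Completion p.Completion where
  smul_assoc c x y := ind₂ p x y (isClosed_eq ((continuous_fst.const_smul c).mul continuous_snd)
      ((continuous_fst.mul continuous_snd).const_smul c)) fun a b => by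
    simp only [smul_eq_mul, ← of_mul, ← map_smul, smul_mul_assoc]

instance [SMulCommClass ℂ A A] : SMulCommClass ℂ p.Completion p.Completion where
  smul_comm c x y := ind₂ p x y (isClosed_eq ((continuous_fst.mul continuous_snd).const_smul c)
      (continuous_fst.mul (continuous_snd.const_smul c))) fun a b => by
    simp only [smul_eq_mul, ← of_mul, ← map_smul, mul_smul_comm]

instance [StarModule ℂ A] : StarModule ℂ p.Completion where
  star_smul c x := ind p x (isClosed_eq (continuous_star.comp (continuous_id.const_smul c))
      (continuous_star.const_smul (star c))) fun a => by
    simp only [← of_star, ← map_smul, star_smul]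

/-- The completion with respect to a C⋆-seminorm is a C⋆-algebra. -/
noncomputable instance [IsScalarTower ℂ A A] [SMulCommClass ℂ A A] [StarModule ℂ A] :
    NonUnitalCStarAlgebra p.Completion where

/-- The canonical map to the completion, as a `*`-homomorphism. -/
noncomputable def ofHom : A →⋆ₙₐ[ℂ] p.Completion where
  toFun a := of p a
  map_smul' c a := (of p).map_smul c a
  map_zero' := (of p).map_zero
  map_add' a b := (of p).map_add a b
  map_mul' a b := of_mul p a b
  map_star' a := of_star p a

lemma norm_ofHom (a : A) : ‖ofHom p a‖ = p.toSeminorm a := (of p).norm_map a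

/-- A `*`-homomorphism to a C⋆-algebra that is dominated by `p` extends to the completion. -/
noncomputable def lift {D : Type*} [NonUnitalCStarAlgebra D] (φ : A →⋆ₙₐ[ℂ] D)
    (hφ : ∀ a, ‖φ a‖ ≤ p.toSeminorm a) : p.Completion →⋆ₙₐ[ℂ] D :=
  let f : p.Space →ₗ[ℂ] D :=
    { toFun := fun a ↦ φ a, map_add' := fun a b ↦ map_add φ a b,
      map_smul' := fun c a ↦ map_smul φ c a }
  let F : p.Completion →L[ℂ] D := f.extendOfNorm (of p).toLinearMap
  have hF : ∀ a : p.Space, F (of p a) = φ a := fun a ↦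
    f.extendOfNorm_eq (e := (of p).toLinearMap) (denseRange_of p)
      ⟨1, fun a ↦ by rw [one_mul]; exact (hφ a).trans_eq ((of p).norm_map a).symm⟩ a
  have hFc : Continuous F := F.continuous
  { toFun := F
    map_smul' := fun c x ↦ map_smul F c x
    map_zero' := map_zero F
    map_add' := map_add F
    map_mul' := fun x y ↦ ind₂ p x y (isClosed_eq (by fun_prop) (by fun_prop)) fun a b => by
      rw [← of_mul, hF, hF, hF]; exact map_mul φ a b
    map_star' := fun x ↦ ind p x (isClosed_eq (by fun_prop) (by fun_prop)) fun a => by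
      rw [← of_star, hF, hF]; exact map_star φ a }

lemma lift_ofHom {D : Type*} [NonUnitalCStarAlgebra D] (φ : A →⋆ₙₐ[ℂ] D)
    (hφ : ∀ a, ‖φ a‖ ≤ p.toSeminorm a) (a : A) : lift p φ hφ (ofHom p a) = φ a :=
  LinearMap.extendOfNorm_eq (e := (of p).toLinearMap) (denseRange_of p)
    ⟨1, fun a ↦ by simpa [Space.norm_def] using hφ a⟩ a

end Completion

end CStarSeminorm

/-- A Fell bundle `{B_t}` over the discrete group `G`: a family of complex Banach spaces with
multiplications `B_r × B_s → B_{rs}` and involutions `B_s → B_{s⁻¹}`, subject to the axioms of a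
`*`-algebra, to `‖ab‖ ≤ ‖a‖‖b‖`, `‖a*‖ = ‖a‖`, `‖a*a‖ = ‖a‖²`, and to `a*a ≥ 0` in the C⋆-algebra
`B_e` (in a C⋆-algebra the positive elements are those of the form `c*c`).

So as not to transport elements along equations in `G`, the product takes its values in `B_t` for
any `t` together with a proof of `r * s = t`, and similarly for the involution. -/
structure FellBundle (G : Type*) [Group G] where
  fiber : G → Type*
  [normedAddCommGroup : ∀ t, NormedAddCommGroup (fiber t)]
  [normedSpace : ∀ t, NormedSpace ℂ (fiber t)]
  [completeSpace : ∀ t, CompleteSpace (fiber t)]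
  mul : ∀ {r s t : G}, r * s = t → fiber r →ₗ[ℂ] fiber s →ₗ[ℂ] fiber t
  adj : ∀ {s t : G}, s⁻¹ = t → fiber s →ₗ⋆[ℂ] fiber t
  assoc : ∀ {r s t rs st rst : G} (h₁ : r * s = rs) (h₂ : rs * t = rst) (h₃ : s * t = st)
    (h₄ : r * st = rst) (a : fiber r) (b : fiber s) (c : fiber t),
    mul h₂ (mul h₁ a b) c = mul h₄ a (mul h₃ b c)
  adj_adj : ∀ {s t : G} (h₁ : s⁻¹ = t) (h₂ : t⁻¹ = s) (a : fiber s), adj h₂ (adj h₁ a) = a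
  adj_mul : ∀ {r s t r' s' t' : G} (h₁ : r * s = t) (h₂ : t⁻¹ = t') (h₃ : r⁻¹ = r') (h₄ : s⁻¹ = s')
    (h₅ : s' * r' = t') (a : fiber r) (b : fiber s),
    adj h₂ (mul h₁ a b) = mul h₅ (adj h₄ b) (adj h₃ a)
  norm_mul : ∀ {r s t : G} (h : r * s = t) (a : fiber r) (b : fiber s),
    ‖mul h a b‖ ≤ ‖a‖ * ‖b‖
  norm_adj : ∀ {s t : G} (h : s⁻¹ = t) (a : fiber s), ‖adj h a‖ = ‖a‖
  norm_adj_mul_self : ∀ {s t : G} (h₁ : s⁻¹ = t) (h₂ : t * s = 1) (a : fiber s),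
    ‖mul h₂ (adj h₁ a) a‖ = ‖a‖ * ‖a‖
  adj_mul_self_nonneg : ∀ {s t : G} (h₁ : s⁻¹ = t) (h₂ : t * s = 1) (a : fiber s),
    ∃ c : fiber 1, mul h₂ (adj h₁ a) a = mul (mul_one 1) (adj inv_one c) c

namespace FellBundle

variable {G : Type*} [Group G] (𝓑 : FellBundle G)

noncomputable instance (t : G) : NormedAddCommGroup (𝓑.fiber t) := 𝓑.normedAddCommGroup t
noncomputable instance (t : G) : NormedSpace ℂ (𝓑.fiber t) := 𝓑.normedSpace t
instance (t : G) : CompleteSpace (𝓑.fiber t) := 𝓑.completeSpace t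

/-- The unit fiber `B_e`. -/
abbrev UnitFiber : Type _ := 𝓑.fiber 1

noncomputable instance : NonUnitalNormedRing 𝓑.UnitFiber :=
  { (inferInstance : NormedAddCommGroup (𝓑.fiber 1)) with
    mul := fun a b ↦ 𝓑.mul (mul_one 1) a b
    left_distrib := fun a b c ↦ map_add (𝓑.mul (mul_one 1) a) b c
    right_distrib := fun a b c ↦ LinearMap.map_add₂ (𝓑.mul (mul_one 1)) a b c
    zero_mul := fun a ↦ LinearMap.map_zero₂ (𝓑.mul (mul_one 1)) a
    mul_zero := fun a ↦ map_zero (𝓑.mul (mul_one 1) a)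
    mul_assoc := fun a b c ↦ 𝓑.assoc _ _ _ _ a b c
    norm_mul_le := fun a b ↦ 𝓑.norm_mul _ a b }

noncomputable instance : StarRing 𝓑.UnitFiber where
  star a := 𝓑.adj inv_one a
  star_involutive a := 𝓑.adj_adj _ _ a
  star_mul a b := 𝓑.adj_mul _ _ _ _ _ a b
  star_add a b := map_add (𝓑.adj inv_one) a b

lemma unitFiber_mul (a b : 𝓑.UnitFiber) : a * b = 𝓑.mul (mul_one 1) a b := rfl
lemma unitFiber_star (a : 𝓑.UnitFiber) : star a = 𝓑.adj inv_one a := rfl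

/-- The unit fiber is a C⋆-algebra. -/
noncomputable instance : NonUnitalCStarAlgebra 𝓑.UnitFiber where
  norm_mul_self_le a := (𝓑.norm_adj_mul_self inv_one (mul_one 1) a).ge
  smul_assoc c a b := LinearMap.map_smul₂ (𝓑.mul (mul_one 1)) c a b
  smul_comm c a b := (map_smul (𝓑.mul (mul_one 1) a) c b).symm
  star_smul c a := LinearMap.map_smulₛₗ (𝓑.adj inv_one) c a
  norm_smul_le := norm_smul_le

noncomputable instance : PartialOrder 𝓑.UnitFiber := CStarAlgebra.spectralOrder _
instance : StarOrderedRing 𝓑.UnitFiber := CStarAlgebra.spectralOrderedRing _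

/-- The space `C_c(𝓑)` of finitely supported sections of the bundle. -/
def Sections : Type _ := DirectSum G 𝓑.fiber

namespace Sections

noncomputable instance : AddCommGroup 𝓑.Sections :=
  inferInstanceAs (AddCommGroup (DirectSum G 𝓑.fiber))
noncomputable instance : Module ℂ 𝓑.Sections :=
  inferInstanceAs (Module ℂ (DirectSum G 𝓑.fiber))

open scoped Classical in
/-- The section with value `b` at `t` and `0` elsewhere. -/
noncomputable def single (t : G) : 𝓑.fiber t →ₗ[ℂ] 𝓑.Sections := DirectSum.lof ℂ G 𝓑.fiber t

open scoped Classical in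
/-- The linear map on sections given by linear maps on the fibers. -/
noncomputable def toModule {M : Type*} [AddCommGroup M] [Module ℂ M]
    (φ : ∀ t, 𝓑.fiber t →ₗ[ℂ] M) : 𝓑.Sections →ₗ[ℂ] M := DirectSum.toModule ℂ G M φ

open scoped Classical in
/-- The additive map on sections given by additive maps on the fibers. -/
noncomputable def toAddMonoid {M : Type*} [AddCommGroup M]
    (φ : ∀ t, 𝓑.fiber t →+ M) : 𝓑.Sections →+ M := DirectSum.toAddMonoid φ

variable {𝓑}

@[simp] lemma toModule_single {M : Type*} [AddCommGroup M] [Module ℂ M]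
    (φ : ∀ t, 𝓑.fiber t →ₗ[ℂ] M) (t : G) (b : 𝓑.fiber t) :
    toModule 𝓑 φ (single 𝓑 t b) = φ t b := by
  classical
  exact DirectSum.toModule_lof (ι := G) (M := 𝓑.fiber) ℂ t (φ := φ) b

@[simp] lemma toAddMonoid_single {M : Type*} [AddCommGroup M]
    (φ : ∀ t, 𝓑.fiber t →+ M) (t : G) (b : 𝓑.fiber t) :
    toAddMonoid 𝓑 φ (single 𝓑 t b) = φ t b := by
  classical
  exact DirectSum.toAddMonoid_of (β := 𝓑.fiber) φ t b

@[elab_as_elim]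
lemma induction {P : 𝓑.Sections → Prop} (f : 𝓑.Sections)
    (single : ∀ t b, P (single 𝓑 t b)) (add : ∀ f g, P f → P g → P (f + g)) : P f := by
  classical
  refine DirectSum.induction_on (β := 𝓑.fiber) (motive := P) f ?_ single add
  have h := single 1 0
  rwa [map_zero] at h

/-- The convolution product `(fg)_t = ∑_{rs = t} f_r g_s`, as a bilinear map. -/
noncomputable def conv : 𝓑.Sections →ₗ[ℂ] 𝓑.Sections →ₗ[ℂ] 𝓑.Sections :=
  toModule 𝓑 fun r ↦ LinearMap.flip <| toModule 𝓑 fun s ↦ LinearMap.flip <|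
    (𝓑.mul (rfl : r * s = r * s)).compr₂ (single 𝓑 (r * s))

noncomputable instance : Mul 𝓑.Sections := ⟨fun f g ↦ conv f g⟩

/-- The involution `(f*)_t = (f_{t⁻¹})*`. -/
noncomputable instance : Star 𝓑.Sections :=
  ⟨toAddMonoid 𝓑 fun s ↦ (single 𝓑 s⁻¹).toAddMonoidHom.comp
    (𝓑.adj (rfl : s⁻¹ = s⁻¹)).toAddMonoidHom⟩

lemma mul_def (f g : 𝓑.Sections) : f * g = conv f g := rfl

lemma single_mul_single {r s t : G} (h : r * s = t) (a : 𝓑.fiber r) (b : 𝓑.fiber s) :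
    single 𝓑 r a * single 𝓑 s b = single 𝓑 t (𝓑.mul h a b) := by
  subst h
  simp [mul_def, conv]

lemma star_single {s t : G} (h : s⁻¹ = t) (a : 𝓑.fiber s) :
    star (single 𝓑 s a) = single 𝓑 t (𝓑.adj h a) := by
  subst h
  exact toAddMonoid_single _ s a

noncomputable instance : NonUnitalRing 𝓑.Sections :=
  { (inferInstance : AddCommGroup 𝓑.Sections), (inferInstance : Mul 𝓑.Sections) with
    left_distrib := fun f g h ↦ map_add (conv f) g h
    right_distrib := fun f g h ↦ LinearMap.map_add₂ conv f g h
    zero_mul := fun f ↦ LinearMap.map_zero₂ conv f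
    mul_zero := fun f ↦ map_zero (conv f)
    mul_assoc := fun f g h ↦ by
      induction f using induction with
      | add f₁ f₂ h₁ h₂ => simp only [mul_def, map_add, LinearMap.add_apply] at h₁ h₂ ⊢; rw [h₁, h₂]
      | single r a =>
      induction g using induction with
      | add f₁ f₂ h₁ h₂ => simp only [mul_def, map_add, LinearMap.add_apply] at h₁ h₂ ⊢; rw [h₁, h₂]
      | single s b =>
      induction h using induction with
      | add f₁ f₂ h₁ h₂ => simp only [mul_def, map_add, LinearMap.add_apply] at h₁ h₂ ⊢; rw [h₁, h₂]
      | single t c =>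
        rw [single_mul_single rfl, single_mul_single rfl, single_mul_single rfl,
          single_mul_single (mul_assoc r s t).symm, 𝓑.assoc] }

instance : IsScalarTower ℂ 𝓑.Sections 𝓑.Sections where
  smul_assoc c f g := LinearMap.map_smul₂ conv c f g

instance : SMulCommClass ℂ 𝓑.Sections 𝓑.Sections where
  smul_comm c f g := (map_smul (conv f) c g).symm

noncomputable instance : StarRing 𝓑.Sections where
  star_add f g := map_add (toAddMonoid 𝓑 fun s ↦ (single 𝓑 s⁻¹).toAddMonoidHom.comp
    (𝓑.adj (rfl : s⁻¹ = s⁻¹)).toAddMonoidHom) f g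
  star_involutive f := by
    have hadd : ∀ f g : 𝓑.Sections, star (f + g) = star f + star g := fun f g ↦
      map_add (toAddMonoid 𝓑 _) f g
    induction f using induction with
    | add f g hf hg => rw [hadd, hadd, hf, hg]
    | single t b => rw [star_single rfl, star_single (inv_inv t), 𝓑.adj_adj]
  star_mul f g := by
    have hadd : ∀ f g : 𝓑.Sections, star (f + g) = star f + star g := fun f g ↦
      map_add (toAddMonoid 𝓑 _) f g
    induction f using induction with
    | add f₁ f₂ h₁ h₂ => rw [add_mul, hadd, hadd, h₁, h₂, mul_add]
    | single r a =>
    induction g using induction with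
    | add f₁ f₂ h₁ h₂ => rw [mul_add, hadd, hadd, h₁, h₂, add_mul]
    | single s b =>
      rw [single_mul_single rfl, star_single rfl, star_single rfl, star_single rfl,
        single_mul_single (mul_inv_rev r s).symm, 𝓑.adj_mul]

instance : StarModule ℂ 𝓑.Sections where
  star_smul c f := by
    induction f using induction with
    | add f g hf hg => rw [smul_add, star_add, star_add, hf, hg, smul_add]
    | single t b => rw [← map_smul, star_single rfl, star_single rfl, LinearMap.map_smulₛₗ,
        map_smul, starRingEnd_apply]

end Sections

/-- A representation of the Fell bundle in a `*`-algebra `D`. -/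
structure Representation (D : Type*) [NonUnitalRing D] [StarRing D] [Module ℂ D] where
  map : ∀ t, 𝓑.fiber t →ₗ[ℂ] D
  map_mul : ∀ {r s t : G} (h : r * s = t) (a : 𝓑.fiber r) (b : 𝓑.fiber s),
    map t (𝓑.mul h a b) = map r a * map s b
  map_adj : ∀ {s t : G} (h : s⁻¹ = t) (a : 𝓑.fiber s), map t (𝓑.adj h a) = star (map s a)

variable {𝓑}

/-- The `*`-homomorphism `f ↦ ∑ π(f_t)` on `C_c(𝓑)` that belongs to a representation `π`. -/
noncomputable def Representation.sectionsHom {D : Type*} [NonUnitalRing D] [StarRing D]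
    [Module ℂ D] [IsScalarTower ℂ D D] [SMulCommClass ℂ D D]
    (π : 𝓑.Representation D) : 𝓑.Sections →⋆ₙₐ[ℂ] D where
  toFun := Sections.toModule 𝓑 π.map
  map_smul' c f := map_smul _ c f
  map_zero' := map_zero _
  map_add' f g := map_add _ f g
  map_mul' f g := by
    induction f using Sections.induction with
    | add f₁ f₂ h₁ h₂ => rw [add_mul, map_add, map_add, h₁, h₂, add_mul]
    | single r a =>
    induction g using Sections.induction with
    | add f₁ f₂ h₁ h₂ => rw [mul_add, map_add, map_add, h₁, h₂, mul_add]
    | single s b => simp [Sections.single_mul_single rfl, π.map_mul]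
  map_star' f := by
    induction f using Sections.induction with
    | add f g hf hg => rw [star_add, map_add, map_add, hf, hg, star_add]
    | single t b => simp [Sections.star_single rfl, π.map_adj]

@[simp] lemma Representation.sectionsHom_single {D : Type*} [NonUnitalRing D] [StarRing D]
    [Module ℂ D] [IsScalarTower ℂ D D] [SMulCommClass ℂ D D]
    (π : 𝓑.Representation D) (t : G) (b : 𝓑.fiber t) :
    π.sectionsHom (Sections.single 𝓑 t b) = π.map t b := Sections.toModule_single π.map t b

/-- The restriction to the fibers of a `*`-homomorphism on `C_c(𝓑)`. -/
noncomputable def Representation.ofSectionsHom {D : Type*} [NonUnitalRing D] [StarRing D]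
    [Module ℂ D] (φ : 𝓑.Sections →⋆ₙₐ[ℂ] D) : 𝓑.Representation D where
  map t := (φ : 𝓑.Sections →ₗ[ℂ] D) ∘ₗ Sections.single 𝓑 t
  map_mul h a b := by simp [← Sections.single_mul_single h]
  map_adj h a := by
    rw [LinearMap.comp_apply, ← Sections.star_single h]
    exact map_star φ _

/-- A representation of the bundle in a C⋆-algebra restricts to a `*`-homomorphism on `B_e`. -/
noncomputable def Representation.unitFiberHom {D : Type*} [NonUnitalRing D] [StarRing D]
    [Module ℂ D] (π : 𝓑.Representation D) : 𝓑.UnitFiber →⋆ₙₐ[ℂ] D where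
  toFun := π.map 1
  map_smul' c f := map_smul _ c f
  map_zero' := map_zero _
  map_add' f g := map_add _ f g
  map_mul' a b := π.map_mul _ a b
  map_star' a := π.map_adj _ a

lemma Representation.norm_map_le {D : Type*} [NonUnitalCStarAlgebra D] (π : 𝓑.Representation D)
    (t : G) (b : 𝓑.fiber t) : ‖π.map t b‖ ≤ ‖b‖ := by
  have h := NonUnitalStarAlgHom.norm_apply_le π.unitFiberHom
    (𝓑.mul (inv_mul_cancel t) (𝓑.adj rfl b) b)
  have h' : π.unitFiberHom (𝓑.mul (inv_mul_cancel t) (𝓑.adj rfl b) b) =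
      star (π.map t b) * π.map t b :=
    (π.map_mul _ _ _).trans (by rw [π.map_adj])
  rw [h', CStarRing.norm_star_mul_self, 𝓑.norm_adj_mul_self] at h
  exact (mul_self_le_mul_self_iff (norm_nonneg _) (norm_nonneg _)).2 h

lemma bddAbove_cstarSeminorm (f : 𝓑.Sections) :
    BddAbove (Set.range fun q : CStarSeminorm 𝓑.Sections ↦ q.toSeminorm f) := by
  induction f using Sections.induction with
  | add f g hf hg =>
    obtain ⟨C, hC⟩ := hf
    obtain ⟨D, hD⟩ := hg
    refine ⟨C + D, ?_⟩
    rintro _ ⟨q, rfl⟩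
    exact (map_add_le_add q.toSeminorm f g).trans (add_le_add (hC ⟨q, rfl⟩) (hD ⟨q, rfl⟩))
  | single t b =>
    refine ⟨‖b‖, ?_⟩
    rintro _ ⟨q, rfl⟩
    have := (Representation.ofSectionsHom (CStarSeminorm.Completion.ofHom q)).norm_map_le t b
    rwa [show (Representation.ofSectionsHom (CStarSeminorm.Completion.ofHom q)).map t b =
      CStarSeminorm.Completion.ofHom q (Sections.single 𝓑 t b) from rfl,
      CStarSeminorm.Completion.norm_ofHom] at this

instance : Nonempty (CStarSeminorm 𝓑.Sections) :=
  ⟨{ (0 : Seminorm ℂ 𝓑.Sections) with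
    mul_le' := fun _ _ ↦ (mul_zero (0 : ℝ)).ge
    star_mul_self' := fun _ ↦ (mul_zero (0 : ℝ)).symm }⟩

variable (𝓑)

/-- The largest C⋆-seminorm on `C_c(𝓑)`: the supremum of all C⋆-seminorms. -/
noncomputable def fullSeminorm : CStarSeminorm 𝓑.Sections where
  toFun f := ⨆ q : CStarSeminorm 𝓑.Sections, q.toSeminorm f
  map_zero' := by simp
  add_le' f g := ciSup_le fun q ↦ (map_add_le_add q.toSeminorm f g).trans
    (add_le_add (le_ciSup (bddAbove_cstarSeminorm f) q) (le_ciSup (bddAbove_cstarSeminorm g) q))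
  neg' f := by simp
  smul' c f := by simp [map_smul_eq_mul, Real.mul_iSup_of_nonneg]
  mul_le' f g := ciSup_le fun q ↦ (q.mul_le' f g).trans <|
    mul_le_mul (le_ciSup (bddAbove_cstarSeminorm f) q) (le_ciSup (bddAbove_cstarSeminorm g) q)
      (apply_nonneg q.toSeminorm g) (Real.iSup_nonneg fun q ↦ apply_nonneg q.toSeminorm f)
  star_mul_self' f := by
    have h0 : ∀ q : CStarSeminorm 𝓑.Sections, 0 ≤ q.toSeminorm f :=
      fun q ↦ apply_nonneg q.toSeminorm f
    have hs : ∀ q : CStarSeminorm 𝓑.Sections,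
        q.toSeminorm (star f * f) = q.toSeminorm f * q.toSeminorm f := fun q ↦ q.star_mul_self' f
    apply le_antisymm
    · refine ciSup_le fun q ↦ ?_
      rw [hs]
      exact mul_self_le_mul_self (h0 q) (le_ciSup (bddAbove_cstarSeminorm f) q)
    · have h1 := bddAbove_cstarSeminorm (star f * f)
      have h2 : (⨆ q : CStarSeminorm 𝓑.Sections, q.toSeminorm f) ≤
          √(⨆ q : CStarSeminorm 𝓑.Sections, q.toSeminorm (star f * f)) :=
        ciSup_le fun q ↦ Real.le_sqrt_of_sq_le <| by
          rw [sq, ← hs]; exact le_ciSup h1 q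
      have h3 : 0 ≤ ⨆ q : CStarSeminorm 𝓑.Sections, q.toSeminorm (star f * f) :=
        Real.iSup_nonneg fun q ↦ apply_nonneg q.toSeminorm _
      exact (mul_self_le_mul_self (Real.iSup_nonneg h0) h2).trans_eq (Real.mul_self_sqrt h3)

/-- The full cross-sectional C⋆-algebra `C*(𝓑)`: the completion of `C_c(𝓑)` in its largest
C⋆-seminorm. As every C⋆-seminorm on `C_c(𝓑)` is bounded by the `ℓ¹`-norm, this is the enveloping
C⋆-algebra of `ℓ¹(𝓑)`. -/
def FullCStar : Type _ := 𝓑.fullSeminorm.Completion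

noncomputable instance : NonUnitalCStarAlgebra 𝓑.FullCStar :=
  inferInstanceAs (NonUnitalCStarAlgebra 𝓑.fullSeminorm.Completion)

/-- The canonical map from `C_c(𝓑)` to `C*(𝓑)`. -/
noncomputable def ofSections : 𝓑.Sections →⋆ₙₐ[ℂ] 𝓑.FullCStar :=
  CStarSeminorm.Completion.ofHom 𝓑.fullSeminorm

/-- The canonical inclusions of the fibers `B_t` in `C*(𝓑)`. -/
noncomputable def ι : 𝓑.Representation 𝓑.FullCStar := Representation.ofSectionsHom 𝓑.ofSections

variable {𝓑}

/-- The C⋆-seminorm given by a `*`-homomorphism to a C⋆-algebra. -/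
noncomputable def seminormOfHom {D : Type*} [NonUnitalCStarAlgebra D] (φ : 𝓑.Sections →⋆ₙₐ[ℂ] D) :
    CStarSeminorm 𝓑.Sections where
  toFun f := ‖φ f‖
  map_zero' := by simp
  add_le' f g := by simpa using norm_add_le (φ f) (φ g)
  neg' f := by simp
  smul' c f := by simp [norm_smul]
  mul_le' f g := by rw [map_mul]; exact _root_.norm_mul_le (φ f) (φ g)
  star_mul_self' f := by rw [map_mul, map_star, CStarRing.norm_star_mul_self]

/-- The integrated form of a representation of the bundle in a C⋆-algebra. -/
noncomputable def Representation.integrated {D : Type*} [NonUnitalCStarAlgebra D]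
    (π : 𝓑.Representation D) : 𝓑.FullCStar →⋆ₙₐ[ℂ] D :=
  CStarSeminorm.Completion.lift 𝓑.fullSeminorm π.sectionsHom fun f ↦
    le_ciSup (bddAbove_cstarSeminorm f) (seminormOfHom π.sectionsHom)

lemma Representation.integrated_ι {D : Type*} [NonUnitalCStarAlgebra D]
    (π : 𝓑.Representation D) (t : G) (b : 𝓑.fiber t) : π.integrated (𝓑.ι.map t b) = π.map t b :=
  (CStarSeminorm.Completion.lift_ofHom 𝓑.fullSeminorm π.sectionsHom _ _).trans
    (π.sectionsHom_single t b)

/-- The restriction to the fibers of a `*`-homomorphism on `C*(𝓑)`. -/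
noncomputable def Representation.restrict {D : Type*} [NonUnitalRing D] [StarRing D]
    [Module ℂ D] (φ : 𝓑.FullCStar →⋆ₙₐ[ℂ] D) : 𝓑.Representation D where
  map t := (φ : 𝓑.FullCStar →ₗ[ℂ] D) ∘ₗ 𝓑.ι.map t
  map_mul h a b := by simp [𝓑.ι.map_mul h]
  map_adj h a := by
    rw [LinearMap.comp_apply, 𝓑.ι.map_adj h]
    exact map_star φ _

end FellBundle

section SesquilinearForm

variable {A M : Type*} [NonUnitalCStarAlgebra A] [PartialOrder A] [StarOrderedRing A]
  [AddCommGroup M] [Module ℂ M]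

/-- The Cauchy–Schwarz inequality for positive `A`-valued sesquilinear forms on right modules. -/
lemma norm_sesquilinear_sq_le (s : M →ₗ⋆[ℂ] M →ₗ[ℂ] A) (act : M → A → M)
    (h_nonneg : ∀ x, 0 ≤ s x x) (h_star : ∀ x y, star (s x y) = s y x)
    (h_act : ∀ x y a, s x (act y a) = s x y * a) (x y : M) :
    ‖s x y‖ ^ 2 ≤ ‖s x x‖ * ‖s y y‖ := by
  have h_act' : ∀ x y a, s (act x a) y = star a * s x y := fun x y a ↦ by
    rw [← h_star, h_act, star_mul, h_star]
  have hr : ∀ (c : ℝ) u v, s u ((c : ℂ) • v) = c • s u v := fun c u v ↦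
    (map_smul (s u) (c : ℂ) v).trans (Complex.coe_smul c _)
  have hl : ∀ (c : ℝ) u v, s ((c : ℂ) • u) v = c • s u v := fun c u v ↦ by
    rw [← h_star, hr, star_smul, h_star, star_trivial]
  obtain ⟨a, ha⟩ : ∃ a, a = s x y := ⟨_, rfl⟩
  have ha' : s y x = star a := by rw [ha, h_star]
  have key : ∀ c : ℝ, (2 * c - ‖s x x‖) • (star a * a) ≤ (c * c) • s y y := by
    intro c
    have h1 := h_nonneg (act x a - (c : ℂ) • y)
    have h2 : s (act x a - (c : ℂ) • y) (act x a - (c : ℂ) • y) =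
        star a * s x x * a - (2 * c) • (star a * a) + (c * c) • s y y := by
      rw [map_sub, map_sub, LinearMap.sub_apply, LinearMap.sub_apply]
      simp only [hl, hr, h_act, h_act', ← ha, ha', mul_assoc]
      module
    have h3 : star a * s x x * a ≤ ‖s x x‖ • (star a * a) :=
      CStarAlgebra.star_left_conjugate_le_norm_smul (IsSelfAdjoint.of_nonneg (h_nonneg x))
    rw [h2] at h1
    have h4 := h1.trans (add_le_add_left (sub_le_sub_right h3 _) _)
    rw [← sub_nonneg]
    convert h4 using 1
    module
  rw [← ha]
  have key2 : ∀ ε : ℝ, 0 < ε → ‖a‖ ^ 2 ≤ ‖s x x‖ * ‖s y y‖ + ε * ‖s y y‖ := fun ε hε ↦ by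
    have h0 := norm_nonneg (s x x)
    have hpos : 0 ≤ 2 * (‖s x x‖ + ε) - ‖s x x‖ := by linarith
    have h5 := CStarAlgebra.norm_le_norm_of_nonneg_of_le
      (smul_nonneg hpos (star_mul_self_nonneg a)) (key (‖s x x‖ + ε))
    rw [norm_smul, norm_smul, CStarRing.norm_star_mul_self, Real.norm_of_nonneg hpos,
      Real.norm_of_nonneg (by positivity)] at h5
    have h6 : (‖s x x‖ + ε) * ‖a‖ ^ 2 ≤ (‖s x x‖ + ε) * ((‖s x x‖ + ε) * ‖s y y‖) := by
      nlinarith [sq_nonneg ‖a‖]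
    have := le_of_mul_le_mul_left h6 (by positivity)
    linarith
  by_contra! hlt
  have hy := norm_nonneg (s y y)
  have h7 := key2 ((‖a‖ ^ 2 - ‖s x x‖ * ‖s y y‖) / (2 * (‖s y y‖ + 1)))
    (div_pos (by linarith) (by positivity))
  rw [div_mul_eq_mul_div, ← sub_le_iff_le_add', le_div_iff₀ (by positivity)] at h7
  nlinarith

/-- The triangle inequality for the seminorm of a positive `A`-valued sesquilinear form. -/
lemma sqrt_norm_sesquilinear_add_le (s : M →ₗ⋆[ℂ] M →ₗ[ℂ] A) (act : M → A → M)
    (h_nonneg : ∀ x, 0 ≤ s x x) (h_star : ∀ x y, star (s x y) = s y x)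
    (h_act : ∀ x y a, s x (act y a) = s x y * a) (x y : M) :
    √‖s (x + y) (x + y)‖ ≤ √‖s x x‖ + √‖s y y‖ := by
  have hxy : ‖s x y‖ ≤ √‖s x x‖ * √‖s y y‖ := by
    rw [← Real.sqrt_mul (norm_nonneg _)]
    exact Real.le_sqrt_of_sq_le (norm_sesquilinear_sq_le s act h_nonneg h_star h_act x y)
  have hyx : ‖s y x‖ ≤ √‖s x x‖ * √‖s y y‖ := by rwa [← h_star, norm_star]
  rw [Real.sqrt_le_left (by positivity)]
  calc ‖s (x + y) (x + y)‖ = ‖s x x + s x y + (s y x + s y y)‖ := by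
        rw [map_add (s (x + y)), map_add s, LinearMap.add_apply, LinearMap.add_apply]; abel_nf
    _ ≤ ‖s x x‖ + ‖s x y‖ + (‖s y x‖ + ‖s y y‖) :=
        (norm_add_le _ _).trans (add_le_add (norm_add_le _ _) (norm_add_le _ _))
    _ ≤ _ := by
        nlinarith [Real.sq_sqrt (norm_nonneg (s x x)), Real.sq_sqrt (norm_nonneg (s y y))]

/-- The comparison test for series of positive elements of a C⋆-algebra. -/
lemma summable_of_nonneg_of_le_cstar {ι : Type*} {f g : ι → A} (hf : ∀ i, 0 ≤ f i)
    (hfg : ∀ i, f i ≤ g i) (hg : Summable g) : Summable f := by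
  rw [summable_iff_vanishing_norm] at hg ⊢
  intro ε hε
  obtain ⟨S, hS⟩ := hg ε hε
  exact ⟨S, fun F hF ↦ (CStarAlgebra.norm_le_norm_of_nonneg_of_le
    (Finset.sum_nonneg fun i _ ↦ hf i) (Finset.sum_le_sum fun i _ ↦ hfg i)).trans_lt (hS F hF)⟩

end SesquilinearForm

namespace FellBundle

variable {G : Type*} [Group G] (𝓑 : FellBundle G)

/-- The `B_e`-valued inner product `⟨a, b⟩ = a*b` on the fiber `B_t`. -/
noncomputable def fiberInner (t : G) : 𝓑.fiber t →ₗ⋆[ℂ] 𝓑.fiber t →ₗ[ℂ] 𝓑.UnitFiber :=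
  (𝓑.mul (inv_mul_cancel t)).comp (𝓑.adj (rfl : t⁻¹ = t⁻¹))

variable {𝓑}

lemma fiberInner_apply {t : G} (a b : 𝓑.fiber t) :
    𝓑.fiberInner t a b = 𝓑.mul (inv_mul_cancel t) (𝓑.adj rfl a) b := rfl

lemma fiberInner_self_nonneg {t : G} (a : 𝓑.fiber t) : 0 ≤ 𝓑.fiberInner t a a := by
  obtain ⟨c, hc⟩ := 𝓑.adj_mul_self_nonneg rfl (inv_mul_cancel t) a
  rw [fiberInner_apply, hc]
  exact star_mul_self_nonneg (R := 𝓑.UnitFiber) c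

lemma norm_fiberInner_self {t : G} (a : 𝓑.fiber t) : ‖𝓑.fiberInner t a a‖ = ‖a‖ * ‖a‖ :=
  𝓑.norm_adj_mul_self _ _ a

lemma star_fiberInner {t : G} (a b : 𝓑.fiber t) :
    star (𝓑.fiberInner t a b) = 𝓑.fiberInner t b a := by
  rw [unitFiber_star, fiberInner_apply,
    𝓑.adj_mul _ _ (inv_inv t) rfl (inv_mul_cancel t), 𝓑.adj_adj, fiberInner_apply]

lemma fiberInner_mul_right {t : G} (a b : 𝓑.fiber t) (c : 𝓑.UnitFiber) :
    𝓑.fiberInner t a (𝓑.mul (mul_one t) b c) = 𝓑.fiberInner t a b * c := by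
  rw [unitFiber_mul, fiberInner_apply, fiberInner_apply, 𝓑.assoc]

lemma fiberInner_mul_left {r s t : G} (h : r * s = t) (h' : r⁻¹ * t = s) (x : 𝓑.fiber r)
    (a : 𝓑.fiber s) (b : 𝓑.fiber t) :
    𝓑.fiberInner t (𝓑.mul h x a) b = 𝓑.fiberInner s a (𝓑.mul h' (𝓑.adj rfl x) b) := by
  have h1 : s⁻¹ * r⁻¹ = t⁻¹ := by rw [← h, mul_inv_rev]
  rw [fiberInner_apply, fiberInner_apply, 𝓑.adj_mul h rfl rfl rfl h1, 𝓑.assoc]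

/-- The operator inequality `(xa)*(xa) ≤ ‖x‖² a*a`. -/
lemma fiberInner_mul_self_le {r s t : G} (h : r * s = t) (x : 𝓑.fiber r) (a : 𝓑.fiber s) :
    𝓑.fiberInner t (𝓑.mul h x a) (𝓑.mul h x a) ≤ (‖x‖ * ‖x‖) • 𝓑.fiberInner s a a := by
  let p : 𝓑.UnitFiber := 𝓑.fiberInner r x x
  have hp : 0 ≤ p := fiberInner_self_nonneg x
  have h' : r⁻¹ * t = s := by rw [← h, inv_mul_cancel_left]
  have hpa : 𝓑.fiberInner t (𝓑.mul h x a) (𝓑.mul h x a) =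
      𝓑.fiberInner s a (𝓑.mul (one_mul s) p a) := by
    rw [fiberInner_mul_left h h', ← 𝓑.assoc (inv_mul_cancel r) (one_mul s) h h']
    rfl
  let : PartialOrder (Unitization ℂ 𝓑.UnitFiber) := CStarAlgebra.spectralOrder _
  have : StarOrderedRing (Unitization ℂ 𝓑.UnitFiber) := CStarAlgebra.spectralOrderedRing _
  have hle : (p : Unitization ℂ 𝓑.UnitFiber) ≤
      algebraMap ℝ (Unitization ℂ 𝓑.UnitFiber) ‖(p : Unitization ℂ 𝓑.UnitFiber)‖ :=
    IsSelfAdjoint.le_algebraMap_norm_self ((IsSelfAdjoint.of_nonneg hp).inr ℂ)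
  rw [Unitization.norm_inr, ← sub_nonneg, CStarAlgebra.nonneg_iff_eq_star_mul_self] at hle
  obtain ⟨q, hq⟩ := hle
  obtain ⟨l, d, hl, hd⟩ : ∃ (l : ℂ) (d : 𝓑.UnitFiber), star l * l = (‖p‖ : ℂ) ∧
      star l • d + l • star d + star d * d = -p := by
    refine ⟨q.fst, q.snd, ?_, ?_⟩
    · have := congr($(hq).fst)
      rw [IsScalarTower.algebraMap_apply ℝ ℂ, Unitization.algebraMap_eq_inl] at this
      simpa [sub_eq_add_neg] using this.symm
    · have := congr($(hq).snd)
      rw [IsScalarTower.algebraMap_apply ℝ ℂ, Unitization.algebraMap_eq_inl] at this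
      simpa [sub_eq_add_neg] using this.symm
  have hnorm : ‖p‖ = ‖x‖ * ‖x‖ := norm_fiberInner_self x
  have hda : ∀ c : 𝓑.UnitFiber, ∀ b : 𝓑.fiber s, 𝓑.fiberInner s (𝓑.mul (one_mul s) c a) b =
      𝓑.fiberInner s a (𝓑.mul (one_mul s) (star c) b) := fun c b ↦ by
    rw [fiberInner_apply, fiberInner_apply,
      𝓑.adj_mul (one_mul s) rfl inv_one rfl (mul_one s⁻¹),
      𝓑.assoc _ (inv_mul_cancel s) (one_mul s) (inv_mul_cancel s), unitFiber_star]
  have hv := fiberInner_self_nonneg (l • a + 𝓑.mul (one_mul s) d a)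
  have hexp : 𝓑.fiberInner s (l • a + 𝓑.mul (one_mul s) d a) (l • a + 𝓑.mul (one_mul s) d a) =
      𝓑.fiberInner s a ((star l * l) • a + 𝓑.mul (one_mul s)
        (star l • d + l • star d + star d * d) a) := by
    simp only [map_add, LinearMap.add_apply, LinearMap.map_smulₛₗ, LinearMap.smul_apply, hda,
      map_smul, unitFiber_mul, 𝓑.assoc (mul_one 1) (one_mul s) (one_mul s) (one_mul s)]
    simp only [starRingEnd_apply]
    module
  rw [hexp, hl, hd, map_add, map_smul, map_neg, LinearMap.neg_apply, map_neg, ← hpa,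
    Complex.coe_smul, hnorm, ← sub_eq_add_neg, sub_nonneg] at hv
  exact hv

end FellBundle

namespace FellBundle

variable {G : Type*} [Group G] (𝓑 : FellBundle G)

/-- The form `∑_{t ∈ F} ⟨ξ_t, η_t⟩` on arbitrary sections, for a finite subset `F` of `G`. -/
noncomputable def partialInner (F : Finset G) :
    (∀ t, 𝓑.fiber t) →ₗ⋆[ℂ] (∀ t, 𝓑.fiber t) →ₗ[ℂ] 𝓑.UnitFiber :=
  ∑ t ∈ F, ((𝓑.fiberInner t).comp (LinearMap.proj t)).compl₂ (LinearMap.proj t)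

/-- The right action of `B_e` on sections. -/
noncomputable def rightAct (ξ : ∀ t, 𝓑.fiber t) (a : 𝓑.UnitFiber) : ∀ t, 𝓑.fiber t :=
  fun t ↦ 𝓑.mul (mul_one t) (ξ t) a

variable {𝓑}

lemma partialInner_apply (F : Finset G) (ξ η : ∀ t, 𝓑.fiber t) :
    𝓑.partialInner F ξ η = ∑ t ∈ F, 𝓑.fiberInner t (ξ t) (η t) := by
  simp [partialInner, LinearMap.sum_apply]

lemma partialInner_self_nonneg (F : Finset G) (ξ : ∀ t, 𝓑.fiber t) :
    0 ≤ 𝓑.partialInner F ξ ξ := by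
  rw [partialInner_apply]
  exact Finset.sum_nonneg fun t _ ↦ fiberInner_self_nonneg _

lemma star_partialInner (F : Finset G) (ξ η : ∀ t, 𝓑.fiber t) :
    star (𝓑.partialInner F ξ η) = 𝓑.partialInner F η ξ := by
  simp only [partialInner_apply, star_sum, star_fiberInner]

lemma partialInner_rightAct (F : Finset G) (ξ η : ∀ t, 𝓑.fiber t) (a : 𝓑.UnitFiber) :
    𝓑.partialInner F ξ (𝓑.rightAct η a) = 𝓑.partialInner F ξ η * a := by
  simp only [partialInner_apply, Finset.sum_mul, rightAct, fiberInner_mul_right]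

lemma summable_fiberInner {ξ η : ∀ t, 𝓑.fiber t}
    (hξ : Summable fun t ↦ 𝓑.fiberInner t (ξ t) (ξ t))
    (hη : Summable fun t ↦ 𝓑.fiberInner t (η t) (η t)) :
    Summable fun t ↦ 𝓑.fiberInner t (ξ t) (η t) := by
  classical
  rw [summable_iff_vanishing_norm] at hξ hη ⊢
  intro ε hε
  obtain ⟨S, hS⟩ := hξ ε hε
  obtain ⟨T, hT⟩ := hη ε hε
  refine ⟨S ∪ T, fun F hF ↦ ?_⟩
  rw [Finset.disjoint_union_right] at hF
  have h := norm_sesquilinear_sq_le (𝓑.partialInner F) 𝓑.rightAct (partialInner_self_nonneg F)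
    (star_partialInner F) (partialInner_rightAct F) ξ η
  simp only [partialInner_apply] at h
  have h1 := hS F hF.1
  have h2 := hT F hF.2
  refine lt_of_pow_lt_pow_left₀ 2 hε.le (h.trans_lt ?_)
  rw [sq]
  exact mul_lt_mul'' h1 h2 (norm_nonneg _) (norm_nonneg _)

variable (𝓑)

/-- The square-summable sections: those for which `∑_t ξ_t* ξ_t` converges in `B_e`
(unconditionally, in norm). -/
def squareSummable : Submodule ℂ (∀ t, 𝓑.fiber t) where
  carrier := {ξ | Summable fun t ↦ 𝓑.fiberInner t (ξ t) (ξ t)}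
  zero_mem' := by simp
  add_mem' {ξ η} hξ hη := by
    have h := (hξ.add (summable_fiberInner hξ hη)).add ((summable_fiberInner hη hξ).add hη)
    refine h.congr fun t ↦ ?_
    simp only [Pi.add_apply, map_add, LinearMap.add_apply]
    abel
  smul_mem' c ξ hξ := by
    refine (hξ.const_smul (star c * c)).congr fun t ↦ ?_
    simp only [Pi.smul_apply, LinearMap.map_smulₛₗ, map_smul, LinearMap.smul_apply, smul_smul]
    rw [mul_comm]; rfl

/-- The Hilbert `B_e`-module `ℓ²(𝓑)` of square-summable sections. -/
def EllTwo : Type _ := 𝓑.squareSummable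

namespace EllTwo

noncomputable instance : AddCommGroup 𝓑.EllTwo := inferInstanceAs (AddCommGroup 𝓑.squareSummable)
noncomputable instance : Module ℂ 𝓑.EllTwo := inferInstanceAs (Module ℂ 𝓑.squareSummable)

/-- The section underlying an element of `ℓ²(𝓑)`. -/
noncomputable def val : 𝓑.EllTwo →ₗ[ℂ] (∀ t, 𝓑.fiber t) := 𝓑.squareSummable.subtype

variable {𝓑}

lemma val_injective : Function.Injective (val 𝓑) := Subtype.val_injective

@[ext] lemma ext {ξ η : 𝓑.EllTwo} (h : ∀ t, val 𝓑 ξ t = val 𝓑 η t) : ξ = η :=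
  val_injective (funext h)

lemma summable_self (ξ : 𝓑.EllTwo) : Summable fun t ↦ 𝓑.fiberInner t (val 𝓑 ξ t) (val 𝓑 ξ t) :=
  ξ.2

lemma summable (ξ η : 𝓑.EllTwo) : Summable fun t ↦ 𝓑.fiberInner t (val 𝓑 ξ t) (val 𝓑 η t) :=
  summable_fiberInner ξ.2 η.2

/-- The element of `ℓ²(𝓑)` given by a square-summable section. -/
def mk (ξ : ∀ t, 𝓑.fiber t) (h : Summable fun t ↦ 𝓑.fiberInner t (ξ t) (ξ t)) : 𝓑.EllTwo := ⟨ξ, h⟩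

@[simp] lemma val_mk (ξ : ∀ t, 𝓑.fiber t) (h) : val 𝓑 (mk ξ h) = ξ := rfl

variable (𝓑) in
/-- The `B_e`-valued inner product `⟨ξ, η⟩ = ∑_t ξ_t* η_t` of `ℓ²(𝓑)`. -/
noncomputable def inner : 𝓑.EllTwo →ₗ⋆[ℂ] 𝓑.EllTwo →ₗ[ℂ] 𝓑.UnitFiber :=
  LinearMap.mk₂'ₛₗ (starRingEnd ℂ) (RingHom.id ℂ)
    (fun ξ η ↦ ∑' t, 𝓑.fiberInner t (val 𝓑 ξ t) (val 𝓑 η t))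
    (fun ξ₁ ξ₂ η ↦ by
      rw [← (summable ξ₁ η).tsum_add (summable ξ₂ η)]
      simp)
    (fun c ξ η ↦ by
      rw [← (summable ξ η).tsum_const_smul]
      simp [LinearMap.map_smulₛₗ])
    (fun ξ η₁ η₂ ↦ by
      rw [← (summable ξ η₁).tsum_add (summable ξ η₂)]
      simp)
    (fun c ξ η ↦ by
      rw [RingHom.id_apply, ← (summable ξ η).tsum_const_smul]
      simp)

lemma inner_apply (ξ η : 𝓑.EllTwo) :
    inner 𝓑 ξ η = ∑' t, 𝓑.fiberInner t (val 𝓑 ξ t) (val 𝓑 η t) := rfl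

lemma hasSum_inner (ξ η : 𝓑.EllTwo) :
    HasSum (fun t ↦ 𝓑.fiberInner t (val 𝓑 ξ t) (val 𝓑 η t)) (inner 𝓑 ξ η) := (summable ξ η).hasSum

lemma inner_self_nonneg (ξ : 𝓑.EllTwo) : 0 ≤ inner 𝓑 ξ ξ :=
  tsum_nonneg fun _ ↦ fiberInner_self_nonneg _

lemma star_inner (ξ η : 𝓑.EllTwo) : star (inner 𝓑 ξ η) = inner 𝓑 η ξ := by
  rw [inner_apply, inner_apply, tsum_star]
  simp only [star_fiberInner]

/-- The right action of `B_e` on `ℓ²(𝓑)`, with `(ξa)_t = ξ_t a`. -/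
noncomputable def act (ξ : 𝓑.EllTwo) (a : 𝓑.UnitFiber) : 𝓑.EllTwo :=
  mk (𝓑.rightAct (val 𝓑 ξ) a) <| by
    refine (((summable_self ξ).mul_right a).mul_left (star a)).congr fun t ↦ ?_
    have h := fiberInner_mul_right (val 𝓑 ξ t) (val 𝓑 ξ t) a
    have h' := congrArg star h
    rw [star_fiberInner, star_mul, star_fiberInner] at h'
    rw [rightAct, fiberInner_mul_right, h', mul_assoc]

lemma inner_act (ξ η : 𝓑.EllTwo) (a : 𝓑.UnitFiber) :
    inner 𝓑 ξ (act η a) = inner 𝓑 ξ η * a := by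
  rw [inner_apply, inner_apply, ← (summable ξ η).tsum_mul_right]
  simp only [act, val_mk, rightAct, fiberInner_mul_right]

lemma sum_le_inner_self (ξ : 𝓑.EllTwo) (F : Finset G) :
    𝓑.partialInner F (val 𝓑 ξ) (val 𝓑 ξ) ≤ inner 𝓑 ξ ξ := by
  rw [partialInner_apply]
  exact (summable_self ξ).sum_le_tsum F fun t _ ↦ fiberInner_self_nonneg _

/-- The norm `‖ξ‖ = ‖⟨ξ, ξ⟩‖^{1/2}`. -/
noncomputable instance : Norm 𝓑.EllTwo := ⟨fun ξ ↦ √‖inner 𝓑 ξ ξ‖⟩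

lemma norm_def (ξ : 𝓑.EllTwo) : ‖ξ‖ = √‖inner 𝓑 ξ ξ‖ := rfl

lemma norm_mul_norm (ξ : 𝓑.EllTwo) : ‖ξ‖ * ‖ξ‖ = ‖inner 𝓑 ξ ξ‖ :=
  Real.mul_self_sqrt (norm_nonneg _)

lemma sqrt_partialInner_le (ξ : 𝓑.EllTwo) (F : Finset G) :
    √‖𝓑.partialInner F (val 𝓑 ξ) (val 𝓑 ξ)‖ ≤ ‖ξ‖ :=
  Real.sqrt_le_sqrt <| CStarAlgebra.norm_le_norm_of_nonneg_of_le (partialInner_self_nonneg _ _)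
    (sum_le_inner_self ξ F)

lemma norm_val_le (ξ : 𝓑.EllTwo) (t : G) : ‖val 𝓑 ξ t‖ ≤ ‖ξ‖ := by
  have h := sqrt_partialInner_le ξ {t}
  rwa [partialInner_apply, Finset.sum_singleton, norm_fiberInner_self,
    Real.sqrt_mul_self (norm_nonneg _)] at h

lemma normedSpaceCore : NormedSpace.Core ℂ 𝓑.EllTwo where
  norm_nonneg ξ := Real.sqrt_nonneg _
  norm_smul c ξ := by
    rw [norm_def, map_smul (inner 𝓑 (c • ξ)), (inner 𝓑).map_smulₛₗ, LinearMap.smul_apply,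
      norm_smul, norm_smul, ← mul_assoc, Real.sqrt_mul (by positivity), RCLike.norm_conj,
      Real.sqrt_mul_self (norm_nonneg _), norm_def]
  norm_triangle ξ η := sqrt_norm_sesquilinear_add_le (inner 𝓑) act inner_self_nonneg star_inner
    inner_act ξ η
  norm_eq_zero_iff ξ := by
    refine ⟨fun h ↦ ?_, fun h ↦ by simp [h, norm_def]⟩
    ext t
    have := norm_val_le ξ t
    rw [h] at this
    simpa using this

noncomputable instance : NormedAddCommGroup 𝓑.EllTwo := NormedAddCommGroup.ofCore normedSpaceCore
noncomputable instance : NormedSpace ℂ 𝓑.EllTwo := NormedSpace.ofCore normedSpaceCore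

lemma norm_inner_le (ξ η : 𝓑.EllTwo) : ‖inner 𝓑 ξ η‖ ≤ ‖ξ‖ * ‖η‖ := by
  have h := norm_sesquilinear_sq_le (inner 𝓑) act inner_self_nonneg star_inner inner_act ξ η
  rw [← norm_mul_norm, ← norm_mul_norm] at h
  refine le_of_sq_le_sq ?_ (by positivity)
  linarith [h, mul_pow ‖ξ‖ ‖η‖ 2, sq ‖ξ‖, sq ‖η‖, mul_mul_mul_comm ‖ξ‖ ‖η‖ ‖ξ‖ ‖η‖]

lemma inner_left_ext {ξ η : 𝓑.EllTwo} (h : ∀ ζ, inner 𝓑 ζ ξ = inner 𝓑 ζ η) : ξ = η := by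
  have h0 : inner 𝓑 (ξ - η) (ξ - η) = 0 := by rw [map_sub (inner 𝓑 (ξ - η)), h, sub_self]
  have h1 := norm_mul_norm (ξ - η)
  rw [h0, norm_zero, mul_self_eq_zero, norm_eq_zero] at h1
  exact sub_eq_zero.1 h1

variable (𝓑) in
/-- The inner product as a continuous sesquilinear map. -/
noncomputable def innerL : 𝓑.EllTwo →L⋆[ℂ] 𝓑.EllTwo →L[ℂ] 𝓑.UnitFiber :=
  LinearMap.mkContinuous₂ (inner 𝓑) 1 fun ξ η ↦ by simpa using norm_inner_le ξ η

lemma innerL_apply (ξ η : 𝓑.EllTwo) : innerL 𝓑 ξ η = inner 𝓑 ξ η := rfl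

lemma norm_le_of_partialInner {ξ : 𝓑.EllTwo} {C : ℝ}
    (h : ∀ F, √‖𝓑.partialInner F (val 𝓑 ξ) (val 𝓑 ξ)‖ ≤ C) : ‖ξ‖ ≤ C := by
  refine le_of_tendsto ((Real.continuous_sqrt.tendsto _).comp (hasSum_inner ξ ξ).norm)
    (Filter.Eventually.of_forall fun F ↦ ?_)
  simpa [partialInner_apply] using h F

lemma norm_fiberInner_le {t : G} (a b : 𝓑.fiber t) : ‖𝓑.fiberInner t a b‖ ≤ ‖a‖ * ‖b‖ := by
  rw [fiberInner_apply, ← 𝓑.norm_adj (rfl : t⁻¹ = t⁻¹) a]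
  exact 𝓑.norm_mul _ _ _

lemma continuous_fiberInner (t : G) :
    Continuous fun p : 𝓑.fiber t × 𝓑.fiber t ↦ 𝓑.fiberInner t p.1 p.2 := by
  let f : 𝓑.fiber t →L⋆[ℂ] 𝓑.fiber t →L[ℂ] 𝓑.UnitFiber :=
    (𝓑.fiberInner t).mkContinuous₂ 1 fun a b ↦ by simpa using norm_fiberInner_le a b
  exact (f.continuous.comp continuous_fst).clm_apply continuous_snd

lemma tendsto_sqrt_partialInner (F : Finset G) {u : ℕ → ∀ t, 𝓑.fiber t} {x : ∀ t, 𝓑.fiber t}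
    (h : ∀ t, Filter.Tendsto (fun n ↦ u n t) Filter.atTop (nhds (x t))) :
    Filter.Tendsto (fun n ↦ √‖𝓑.partialInner F (u n) (u n)‖) Filter.atTop
      (nhds √‖𝓑.partialInner F x x‖) := by
  simp only [partialInner_apply]
  refine (Real.continuous_sqrt.tendsto _).comp (tendsto_finsetSum F fun t _ ↦ ?_).norm
  exact ((continuous_fiberInner t).tendsto (x t, x t)).comp ((h t).prodMk_nhds (h t))

/-- `ℓ²(𝓑)` is complete. -/
instance : CompleteSpace 𝓑.EllTwo := by
  refine Metric.complete_of_cauchySeq_tendsto fun u hu ↦ ?_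
  have hcoord : ∀ t, ∃ y, Filter.Tendsto (fun n ↦ val 𝓑 (u n) t) Filter.atTop (nhds y) := fun t ↦ by
    refine cauchySeq_tendsto_of_complete (Metric.cauchySeq_iff.2 fun ε hε ↦ ?_)
    obtain ⟨N, hN⟩ := Metric.cauchySeq_iff.1 hu ε hε
    refine ⟨N, fun m hm n hn ↦ lt_of_le_of_lt ?_ (hN m hm n hn)⟩
    rw [dist_eq_norm, dist_eq_norm]
    simpa using norm_val_le (u m - u n) t
  choose x hx using hcoord
  have key : ∀ ε > 0, ∃ N, ∀ n ≥ N, ∀ F,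
      √‖𝓑.partialInner F (val 𝓑 (u n) - x) (val 𝓑 (u n) - x)‖ ≤ ε := fun ε hε ↦ by
    obtain ⟨N, hN⟩ := Metric.cauchySeq_iff.1 hu ε hε
    refine ⟨N, fun n hn F ↦ ?_⟩
    refine le_of_tendsto (tendsto_sqrt_partialInner F
      (u := fun m ↦ val 𝓑 (u n) - val 𝓑 (u m)) fun t ↦ (hx t).const_sub _) ?_
    filter_upwards [Filter.eventually_ge_atTop N] with m hm
    rw [← map_sub]
    refine (sqrt_partialInner_le (u n - u m) F).trans ?_
    rw [← dist_eq_norm]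
    exact (hN n hn m hm).le
  have hsum : Summable fun t ↦ 𝓑.fiberInner t (x t) (x t) := by
    rw [summable_iff_vanishing_norm]
    intro ε hε
    have hδ : 0 < √ε / 3 := by positivity
    obtain ⟨N, hN⟩ := key (√ε / 3) hδ
    obtain ⟨S, hS⟩ := summable_iff_vanishing_norm.1 (summable_self (u N)) ((√ε / 3) ^ 2)
      (by positivity)
    refine ⟨S, fun F hF ↦ ?_⟩
    rw [← partialInner_apply]
    have h1 := sqrt_norm_sesquilinear_add_le (𝓑.partialInner F) 𝓑.rightAct
      (partialInner_self_nonneg F) (star_partialInner F) (partialInner_rightAct F)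
      (-(val 𝓑 (u N) - x)) (val 𝓑 (u N))
    have h2 := hN N le_rfl F
    have h3 : √‖𝓑.partialInner F (val 𝓑 (u N)) (val 𝓑 (u N))‖ ≤ √ε / 3 := by
      rw [Real.sqrt_le_left hδ.le, partialInner_apply]
      exact (hS F hF).le
    rw [neg_sub, sub_add_cancel, ← neg_sub, map_neg, LinearMap.map_neg₂, neg_neg] at h1
    exact (Real.sqrt_lt_sqrt_iff (norm_nonneg _)).1 (by linarith)
  refine ⟨mk x hsum, Metric.tendsto_atTop.2 fun ε hε ↦ ?_⟩
  obtain ⟨N, hN⟩ := key (ε / 2) (by positivity)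
  refine ⟨N, fun n hn ↦ ?_⟩
  rw [dist_eq_norm]
  refine lt_of_le_of_lt (norm_le_of_partialInner (C := ε / 2) fun F ↦ ?_) (by linarith)
  rw [map_sub, val_mk]
  exact hN n hn F

end EllTwo

end FellBundle

namespace FellBundle

variable {G : Type*} [Group G] (𝓑 : FellBundle G)

/-- The algebra `𝓛(ℓ²(𝓑))` of adjointable operators on the Hilbert module `ℓ²(𝓑)`. -/
noncomputable def adjointableSubalgebra : Subalgebra ℂ (𝓑.EllTwo →L[ℂ] 𝓑.EllTwo) where
  carrier := {T | ∃ S : 𝓑.EllTwo →L[ℂ] 𝓑.EllTwo,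
    ∀ ξ η, EllTwo.inner 𝓑 (T ξ) η = EllTwo.inner 𝓑 ξ (S η)}
  mul_mem' := by
    rintro T₁ T₂ ⟨S₁, h₁⟩ ⟨S₂, h₂⟩
    exact ⟨S₂ * S₁, fun ξ η ↦ (h₁ _ _).trans (h₂ _ _)⟩
  add_mem' := by
    rintro T₁ T₂ ⟨S₁, h₁⟩ ⟨S₂, h₂⟩
    exact ⟨S₁ + S₂, fun ξ η ↦ by
      rw [_root_.add_apply, _root_.add_apply, map_add, map_add,
        LinearMap.add_apply, h₁, h₂]⟩
  algebraMap_mem' c := ⟨star c • 1, fun ξ η ↦ by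
    simp [Algebra.algebraMap_eq_smul_one, LinearMap.map_smulₛₗ]⟩

/-- The C⋆-algebra `𝓛(ℓ²(𝓑))` of adjointable operators, with the operator norm. -/
def Adjointable : Type _ := 𝓑.adjointableSubalgebra

namespace Adjointable

noncomputable instance : NormedRing 𝓑.Adjointable :=
  inferInstanceAs (NormedRing 𝓑.adjointableSubalgebra)
noncomputable instance : NormedAlgebra ℂ 𝓑.Adjointable :=
  inferInstanceAs (NormedAlgebra ℂ 𝓑.adjointableSubalgebra)

/-- The operator underlying an adjointable operator. -/
noncomputable def toCLM : 𝓑.Adjointable →ₐ[ℂ] (𝓑.EllTwo →L[ℂ] 𝓑.EllTwo) :=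
  𝓑.adjointableSubalgebra.val

variable {𝓑}

lemma toCLM_injective : Function.Injective (toCLM 𝓑) := Subtype.val_injective

lemma norm_toCLM (T : 𝓑.Adjointable) : ‖toCLM 𝓑 T‖ = ‖T‖ := rfl

/-- The adjointable operator given by a pair of adjoint operators. -/
noncomputable def mk (T S : 𝓑.EllTwo →L[ℂ] 𝓑.EllTwo)
    (h : ∀ ξ η, EllTwo.inner 𝓑 (T ξ) η = EllTwo.inner 𝓑 ξ (S η)) : 𝓑.Adjointable := ⟨T, S, h⟩

@[simp] lemma toCLM_mk (T S : 𝓑.EllTwo →L[ℂ] 𝓑.EllTwo) (h) : toCLM 𝓑 (mk T S h) = T := rfl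

lemma exists_adjoint (T : 𝓑.Adjointable) : ∃ S : 𝓑.EllTwo →L[ℂ] 𝓑.EllTwo,
    ∀ ξ η, EllTwo.inner 𝓑 (toCLM 𝓑 T ξ) η = EllTwo.inner 𝓑 ξ (S η) := T.2

lemma inner_symm {T S : 𝓑.EllTwo →L[ℂ] 𝓑.EllTwo}
    (h : ∀ ξ η, EllTwo.inner 𝓑 (T ξ) η = EllTwo.inner 𝓑 ξ (S η)) (ξ η : 𝓑.EllTwo) :
    EllTwo.inner 𝓑 (S ξ) η = EllTwo.inner 𝓑 ξ (T η) := by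
  rw [← EllTwo.star_inner, ← h, EllTwo.star_inner]

/-- The adjoint `T*`, characterized by `⟨Tξ, η⟩ = ⟨ξ, T*η⟩`. -/
noncomputable instance : Star 𝓑.Adjointable :=
  ⟨fun T ↦ mk T.exists_adjoint.choose (toCLM 𝓑 T) (inner_symm T.exists_adjoint.choose_spec)⟩

lemma inner_star (T : 𝓑.Adjointable) (ξ η : 𝓑.EllTwo) :
    EllTwo.inner 𝓑 (toCLM 𝓑 T ξ) η = EllTwo.inner 𝓑 ξ (toCLM 𝓑 (star T) η) :=
  T.exists_adjoint.choose_spec ξ η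

lemma eq_star {T S : 𝓑.Adjointable}
    (h : ∀ ξ η, EllTwo.inner 𝓑 (toCLM 𝓑 T ξ) η = EllTwo.inner 𝓑 ξ (toCLM 𝓑 S η)) :
    S = star T :=
  toCLM_injective <| ContinuousLinearMap.ext fun η ↦ EllTwo.inner_left_ext fun ξ ↦ by
    rw [← h, inner_star]

noncomputable instance : StarRing 𝓑.Adjointable where
  star_involutive T := (eq_star fun ξ η ↦ inner_symm (inner_star T) ξ η).symm
  star_mul T S := (eq_star fun ξ η ↦ by
    rw [map_mul, map_mul, mul_apply_eq_comp, mul_apply_eq_comp,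
      inner_star, inner_star]).symm
  star_add T S := (eq_star fun ξ η ↦ by
    rw [map_add, map_add, _root_.add_apply, _root_.add_apply, map_add,
      map_add, LinearMap.add_apply, inner_star, inner_star]).symm

instance : StarModule ℂ 𝓑.Adjointable where
  star_smul c T := (eq_star fun ξ η ↦ by
    rw [map_smul, map_smul, _root_.smul_apply, _root_.smul_apply,
      map_smul (EllTwo.inner 𝓑 ξ), (EllTwo.inner 𝓑).map_smulₛₗ, LinearMap.smul_apply, inner_star,
      starRingEnd_apply]).symm

instance : CStarRing 𝓑.Adjointable where
  norm_mul_self_le T := by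
    have h : ‖T‖ ≤ √‖star T * T‖ := by
      refine (toCLM 𝓑 T).opNorm_le_bound (Real.sqrt_nonneg _) fun ξ ↦ ?_
      refine le_of_sq_le_sq ?_ (by positivity)
      have h1 := EllTwo.norm_inner_le ξ (toCLM 𝓑 (star T * T) ξ)
      have h2 : EllTwo.inner 𝓑 ξ (toCLM 𝓑 (star T * T) ξ) =
          EllTwo.inner 𝓑 (toCLM 𝓑 T ξ) (toCLM 𝓑 T ξ) := by
        rw [inner_star, map_mul, mul_apply_eq_comp]
      have h3 : ‖toCLM 𝓑 (star T * T) ξ‖ ≤ ‖star T * T‖ * ‖ξ‖ :=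
        (toCLM 𝓑 (star T * T)).le_opNorm ξ
      rw [h2, ← EllTwo.norm_mul_norm] at h1
      rw [mul_pow, Real.sq_sqrt (norm_nonneg _)]
      nlinarith [norm_nonneg ξ, mul_le_mul_of_nonneg_left h3 (norm_nonneg ξ)]
    exact (mul_self_le_mul_self (norm_nonneg _) h).trans_eq (Real.mul_self_sqrt (norm_nonneg _))

instance : CompleteSpace 𝓑.Adjointable := by
  refine Metric.complete_of_cauchySeq_tendsto fun u hu ↦ ?_
  have hc : ∀ {v : ℕ → 𝓑.Adjointable}, CauchySeq v →
      ∃ S, Filter.Tendsto (fun n ↦ toCLM 𝓑 (v n)) Filter.atTop (nhds S) := fun {v} hv ↦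
    cauchySeq_tendsto_of_complete (hv.map uniformContinuous_subtype_val)
  obtain ⟨T, hT⟩ := hc hu
  obtain ⟨S, hS⟩ := hc (v := fun n ↦ star (u n))
    (hu.map (starₗᵢ ℂ : 𝓑.Adjointable ≃ₗᵢ⋆[ℂ] 𝓑.Adjointable).isometry.uniformContinuous)
  refine ⟨mk T S fun ξ η ↦ ?_, tendsto_subtype_rng.2 hT⟩
  have h1 : Filter.Tendsto (fun n ↦ EllTwo.innerL 𝓑 (toCLM 𝓑 (u n) ξ) η) Filter.atTop
      (nhds (EllTwo.innerL 𝓑 (T ξ) η)) :=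
    (((EllTwo.innerL 𝓑).flip η).continuous.tendsto _).comp
      (((ContinuousLinearMap.apply ℂ 𝓑.EllTwo ξ).continuous.tendsto T).comp hT)
  have h2 : Filter.Tendsto (fun n ↦ EllTwo.innerL 𝓑 ξ (toCLM 𝓑 (star (u n)) η)) Filter.atTop
      (nhds (EllTwo.innerL 𝓑 ξ (S η))) :=
    ((EllTwo.innerL 𝓑 ξ).continuous.tendsto _).comp
      (((ContinuousLinearMap.apply ℂ 𝓑.EllTwo η).continuous.tendsto S).comp hS)
  refine tendsto_nhds_unique h1 (h2.congr fun n ↦ ?_)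
  rw [EllTwo.innerL_apply, EllTwo.innerL_apply, inner_star]

noncomputable instance : CStarAlgebra 𝓑.Adjointable where

end Adjointable

/-- The left regular operator of `b ∈ B_r` on sections: `(bξ)_t = b ξ_{r⁻¹t}`. -/
noncomputable def leftMulSection {r : G} (b : 𝓑.fiber r) (ξ : ∀ t, 𝓑.fiber t) : ∀ t, 𝓑.fiber t :=
  fun t ↦ 𝓑.mul (mul_inv_cancel_left r t) b (ξ (r⁻¹ * t))

variable {𝓑}

lemma summable_leftMulSection {r : G} (b : 𝓑.fiber r) (ξ : 𝓑.EllTwo) :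
    Summable fun t ↦ 𝓑.fiberInner t (𝓑.leftMulSection b (EllTwo.val 𝓑 ξ) t)
      (𝓑.leftMulSection b (EllTwo.val 𝓑 ξ) t) :=
  summable_of_nonneg_of_le_cstar (fun _ ↦ fiberInner_self_nonneg _)
    (fun t ↦ fiberInner_mul_self_le (mul_inv_cancel_left r t) b _)
    (((Equiv.mulLeft r⁻¹).summable_iff.2 ξ.summable_self).const_smul (‖b‖ * ‖b‖))

/-- The linear map `ξ ↦ bξ` on `ℓ²(𝓑)`. -/
noncomputable def leftMulLinear {r : G} (b : 𝓑.fiber r) : 𝓑.EllTwo →ₗ[ℂ] 𝓑.EllTwo where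
  toFun ξ := EllTwo.mk (𝓑.leftMulSection b (EllTwo.val 𝓑 ξ)) (summable_leftMulSection b ξ)
  map_add' _ _ := EllTwo.ext fun _ ↦ map_add (𝓑.mul _ b) _ _
  map_smul' c _ := EllTwo.ext fun _ ↦ map_smul (𝓑.mul _ b) c _

lemma val_leftMulLinear {r : G} (b : 𝓑.fiber r) (ξ : 𝓑.EllTwo) (t : G) :
    EllTwo.val 𝓑 (leftMulLinear b ξ) t =
      𝓑.mul (mul_inv_cancel_left r t) b (EllTwo.val 𝓑 ξ (r⁻¹ * t)) := rfl

lemma norm_leftMulLinear_le {r : G} (b : 𝓑.fiber r) (ξ : 𝓑.EllTwo) :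
    ‖leftMulLinear b ξ‖ ≤ ‖b‖ * ‖ξ‖ := by
  have h : ‖EllTwo.inner 𝓑 (leftMulLinear b ξ) (leftMulLinear b ξ)‖ ≤
      ‖(‖b‖ * ‖b‖) • EllTwo.inner 𝓑 ξ ξ‖ := by
    refine CStarAlgebra.norm_le_norm_of_nonneg_of_le (EllTwo.inner_self_nonneg _) ?_
    have h1 := ((Equiv.mulLeft r⁻¹).hasSum_iff.2 (EllTwo.hasSum_inner ξ ξ)).const_smul (‖b‖ * ‖b‖)
    refine hasSum_le (fun t ↦ ?_) (EllTwo.hasSum_inner _ _) h1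
    rw [val_leftMulLinear]
    exact fiberInner_mul_self_le (mul_inv_cancel_left r t) b _
  rw [norm_smul, ← EllTwo.norm_mul_norm, ← EllTwo.norm_mul_norm,
    Real.norm_of_nonneg (mul_self_nonneg _), mul_mul_mul_comm] at h
  exact (mul_self_le_mul_self_iff (norm_nonneg _)
    (mul_nonneg (norm_nonneg _) (norm_nonneg _))).2 h

/-- The left regular operator of `b ∈ B_r` on `ℓ²(𝓑)`: `(bξ)_t = b ξ_{r⁻¹t}`. -/
noncomputable def leftMul {r : G} (b : 𝓑.fiber r) : 𝓑.EllTwo →L[ℂ] 𝓑.EllTwo :=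
  (leftMulLinear b).mkContinuous ‖b‖ (norm_leftMulLinear_le b)

lemma val_leftMul {r : G} (b : 𝓑.fiber r) (ξ : 𝓑.EllTwo) (t : G) :
    EllTwo.val 𝓑 (leftMul b ξ) t =
      𝓑.mul (mul_inv_cancel_left r t) b (EllTwo.val 𝓑 ξ (r⁻¹ * t)) := rfl

lemma mul_section_congr {r s s' t : G} (h : r * s = t) (h' : r * s' = t) (b : 𝓑.fiber r)
    (ξ : ∀ t, 𝓑.fiber t) : 𝓑.mul h b (ξ s) = 𝓑.mul h' b (ξ s') := by
  obtain rfl : s = s' := mul_left_cancel (h.trans h'.symm)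
  rfl

lemma inner_leftMul {r : G} (b : 𝓑.fiber r) (ξ η : 𝓑.EllTwo) :
    EllTwo.inner 𝓑 (leftMul b ξ) η =
      EllTwo.inner 𝓑 ξ (leftMul (𝓑.adj (rfl : r⁻¹ = r⁻¹) b) η) := by
  refine (EllTwo.hasSum_inner (leftMul b ξ) η).unique ?_
  rw [← (Equiv.mulLeft r).hasSum_iff]
  convert EllTwo.hasSum_inner ξ (leftMul (𝓑.adj (rfl : r⁻¹ = r⁻¹) b) η) using 1
  funext s
  change 𝓑.fiberInner (r * s) (EllTwo.val 𝓑 (leftMul b ξ) (r * s)) (EllTwo.val 𝓑 η (r * s)) = _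
  rw [val_leftMul, val_leftMul, mul_section_congr _ (rfl : r * s = r * s),
    fiberInner_mul_left rfl (inv_mul_cancel_left r s),
    mul_section_congr _ (mul_inv_cancel_left r⁻¹ s)]

variable (𝓑)

/-- The left regular representation of the bundle on `ℓ²(𝓑)`. -/
noncomputable def regularRep : 𝓑.Representation 𝓑.Adjointable where
  map r :=
    { toFun := fun b ↦ Adjointable.mk (leftMul b) (leftMul (𝓑.adj rfl b)) (inner_leftMul b)
      map_add' := fun a b ↦ Adjointable.toCLM_injective <| ContinuousLinearMap.ext fun ξ ↦
        EllTwo.ext fun t ↦ LinearMap.map_add₂ (𝓑.mul _) a b _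
      map_smul' := fun c b ↦ Adjointable.toCLM_injective <| ContinuousLinearMap.ext fun ξ ↦
        EllTwo.ext fun t ↦ LinearMap.map_smul₂ (𝓑.mul _) c b _ }
  map_mul {r s t} h a b := Adjointable.toCLM_injective <| ContinuousLinearMap.ext fun ξ ↦
    EllTwo.ext fun u ↦ by
      subst h
      have h1 : s * ((r * s)⁻¹ * u) = r⁻¹ * u := by group
      change 𝓑.mul _ (𝓑.mul _ a b) (EllTwo.val 𝓑 ξ ((r * s)⁻¹ * u)) =
        𝓑.mul (mul_inv_cancel_left r u) a
          (𝓑.mul (mul_inv_cancel_left s (r⁻¹ * u)) b (EllTwo.val 𝓑 ξ (s⁻¹ * (r⁻¹ * u))))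
      rw [𝓑.assoc _ _ h1 (mul_inv_cancel_left r u), mul_section_congr h1]
  map_adj {s t} h b := Adjointable.eq_star fun ξ η ↦ by
    subst h
    exact inner_leftMul b ξ η

/-- The reduced cross-sectional C⋆-algebra `C*_r(𝓑)`: the closure in `𝓛(ℓ²(𝓑))` of the algebra of
the left regular operators of finitely supported sections. -/
noncomputable def reducedSubalgebra : NonUnitalStarSubalgebra ℂ 𝓑.Adjointable :=
  (NonUnitalStarAlgHom.range 𝓑.regularRep.sectionsHom).topologicalClosure

/-- The reduced cross-sectional C⋆-algebra `C*_r(𝓑)`. -/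
def ReducedCStar : Type _ := 𝓑.reducedSubalgebra

noncomputable instance : NonUnitalCStarAlgebra 𝓑.ReducedCStar :=
  have : IsClosed (𝓑.reducedSubalgebra : Set 𝓑.Adjointable) :=
    NonUnitalStarSubalgebra.isClosed_topologicalClosure _
  inferInstanceAs (NonUnitalCStarAlgebra 𝓑.reducedSubalgebra)

/-- The canonical inclusions of the fibers `B_t` in `C*_r(𝓑)`. -/
noncomputable def ιr : 𝓑.Representation 𝓑.ReducedCStar where
  map t := (𝓑.regularRep.map t).codRestrict 𝓑.reducedSubalgebra.toSubmodule fun b ↦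
    subset_closure ⟨Sections.single 𝓑 t b, 𝓑.regularRep.sectionsHom_single t b⟩
  map_mul h a b := Subtype.ext (𝓑.regularRep.map_mul h a b)
  map_adj h a := Subtype.ext (𝓑.regularRep.map_adj h a)

/-- The regular map `Λ : C*(𝓑) → C*_r(𝓑)`, the identity on each fiber `B_t`. -/
noncomputable def Λ : 𝓑.FullCStar →⋆ₙₐ[ℂ] 𝓑.ReducedCStar := 𝓑.ιr.integrated

lemma Λ_ι (t : G) (b : 𝓑.fiber t) : 𝓑.Λ (𝓑.ι.map t b) = 𝓑.ιr.map t b :=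
  Representation.integrated_ι _ t b

end FellBundle

section TensorRegular

open scoped TensorProduct

/-- The Hilbert space `ℓ²(G)`. -/
abbrev EllTwoGroup (G : Type*) : Type _ := lp (fun _ : G ↦ ℂ) 2

/-- The tensor product of two Hilbert spaces: the completion of the algebraic tensor product. -/
abbrev HilbertTensor (H K : Type*) [NormedAddCommGroup H] [InnerProductSpace ℂ H]
    [NormedAddCommGroup K] [InnerProductSpace ℂ K] : Type _ := UniformSpace.Completion (H ⊗[ℂ] K)

variable {G : Type*} [Group G]

/-- The left regular representation of `G` on `ℓ²(G)`: `(λ_t f)(s) = f(t⁻¹s)`, that is,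
`λ_t δ_s = δ_{ts}`. -/
noncomputable def leftRegular (t : G) : EllTwoGroup G →ₗᵢ[ℂ] EllTwoGroup G where
  toFun f := ⟨fun s ↦ f (t⁻¹ * s), by
    have h := (memℓp_gen_iff (p := 2) (by norm_num)).1 f.2
    exact (memℓp_gen_iff (p := 2) (by norm_num)).2 ((Equiv.mulLeft t⁻¹).summable_iff.2 h)⟩
  map_add' _ _ := rfl
  map_smul' _ _ := rfl
  norm_map' f := by
    rw [lp.norm_eq_tsum_rpow (p := 2) (by norm_num), lp.norm_eq_tsum_rpow (p := 2) (by norm_num)]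
    congr 1
    exact (Equiv.mulLeft t⁻¹).tsum_eq fun s ↦ ‖f s‖ ^ (2 : ENNReal).toReal

lemma leftRegular_apply (t : G) (f : EllTwoGroup G) (s : G) : leftRegular t f s = f (t⁻¹ * s) := rfl

lemma leftRegular_mul (r s : G) :
    (leftRegular (r * s)).toContinuousLinearMap =
      (leftRegular r).toContinuousLinearMap * (leftRegular s).toContinuousLinearMap := by
  ext f u
  change f ((r * s)⁻¹ * u) = f (s⁻¹ * (r⁻¹ * u))
  rw [mul_inv_rev, mul_assoc]

lemma inner_leftRegular (t : G) (f g : EllTwoGroup G) :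
    inner ℂ (leftRegular t f) g = inner ℂ f (leftRegular t⁻¹ g) := by
  rw [lp.inner_eq_tsum, lp.inner_eq_tsum, ← (Equiv.mulLeft t).tsum_eq]
  simp [leftRegular_apply]

section

variable {H K : Type*} [NormedAddCommGroup H] [InnerProductSpace ℂ H]
  [NormedAddCommGroup K] [InnerProductSpace ℂ K]

/-- The operator `T ⊗ S` on the tensor product of Hilbert spaces, with
`(T ⊗ S)(ξ ⊗ η) = Tξ ⊗ Sη`. -/
noncomputable def tensorOp (T : H →L[ℂ] H) (S : K →L[ℂ] K) :
    HilbertTensor H K →L[ℂ] HilbertTensor H K := (TensorProduct.mapL T S).completion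

lemma tensorOp_tmul (T : H →L[ℂ] H) (S : K →L[ℂ] K) (ξ : H) (η : K) :
    tensorOp T S ((ξ ⊗ₜ[ℂ] η : H ⊗[ℂ] K) : HilbertTensor H K) =
      ((T ξ ⊗ₜ[ℂ] S η : H ⊗[ℂ] K) : HilbertTensor H K) := by
  simp [tensorOp]

lemma clm_hilbertTensor_ext {T T' : HilbertTensor H K →L[ℂ] HilbertTensor H K}
    (h : ∀ (ξ : H) (η : K), T ((ξ ⊗ₜ[ℂ] η : H ⊗[ℂ] K) : HilbertTensor H K) =
      T' ((ξ ⊗ₜ[ℂ] η : H ⊗[ℂ] K) : HilbertTensor H K)) : T = T' := by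
  ext x
  induction x using UniformSpace.Completion.induction_on with
  | hp => exact isClosed_eq T.continuous T'.continuous
  | ih x =>
    induction x using TensorProduct.induction_on with
    | zero => rw [UniformSpace.Completion.coe_zero, map_zero, map_zero]
    | tmul ξ η => exact h ξ η
    | add x y hx hy => rw [UniformSpace.Completion.coe_add, map_add, map_add, hx, hy]

lemma inner_mapL {T T' : H →L[ℂ] H} {S S' : K →L[ℂ] K}
    (hT : ∀ x y, inner ℂ (T x) y = inner ℂ x (T' y))
    (hS : ∀ x y, inner ℂ (S x) y = inner ℂ x (S' y)) (x y : H ⊗[ℂ] K) :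
    inner ℂ (TensorProduct.mapL T S x) y = inner ℂ x (TensorProduct.mapL T' S' y) := by
  induction x using TensorProduct.induction_on with
  | zero => simp
  | add x₁ x₂ h₁ h₂ => rw [map_add, inner_add_left, inner_add_left, h₁, h₂]
  | tmul ξ η =>
    induction y using TensorProduct.induction_on with
    | zero => simp
    | add x₁ x₂ h₁ h₂ => rw [map_add, inner_add_right, inner_add_right, h₁, h₂]
    | tmul ξ' η' => simp [hT, hS]

lemma inner_tensorOp {T T' : H →L[ℂ] H} {S S' : K →L[ℂ] K}
    (hT : ∀ x y, inner ℂ (T x) y = inner ℂ x (T' y))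
    (hS : ∀ x y, inner ℂ (S x) y = inner ℂ x (S' y)) (x y : HilbertTensor H K) :
    inner ℂ (tensorOp T S x) y = inner ℂ x (tensorOp T' S' y) := by
  induction x, y using UniformSpace.Completion.induction_on₂ with
  | hp => apply isClosed_eq <;> fun_prop
  | ih x y =>
    simp only [tensorOp, ContinuousLinearMap.completion_apply_coe,
      UniformSpace.Completion.inner_coe]
    exact inner_mapL hT hS x y

end

namespace FellBundle

variable {𝓑 : FellBundle G} {H : Type*} [NormedAddCommGroup H] [InnerProductSpace ℂ H]
  [CompleteSpace H]

/-- The representation `π ⊗ λ` of the bundle on `H ⊗ ℓ²(G)`, `(π ⊗ λ)(b_t) = π(b_t) ⊗ λ_t`. -/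
noncomputable def Representation.tensorRegular (π : 𝓑.Representation (H →L[ℂ] H)) :
    𝓑.Representation (HilbertTensor H (EllTwoGroup G) →L[ℂ] HilbertTensor H (EllTwoGroup G)) where
  map t :=
    { toFun := fun b ↦ tensorOp (π.map t b) (leftRegular t).toContinuousLinearMap
      map_add' := fun a b ↦ clm_hilbertTensor_ext fun ξ η ↦ by
        simp [tensorOp_tmul, TensorProduct.add_tmul, UniformSpace.Completion.coe_add]
      map_smul' := fun c b ↦ clm_hilbertTensor_ext fun ξ η ↦ by
        simp [tensorOp_tmul, ← TensorProduct.smul_tmul', UniformSpace.Completion.coe_smul] }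
  map_mul {r s t} h a b := clm_hilbertTensor_ext fun ξ η ↦ by
    subst h
    simp [tensorOp_tmul, π.map_mul rfl, leftRegular_mul]
  map_adj {s t} h b := by
    subst h
    refine (ContinuousLinearMap.eq_adjoint_iff _ _).2 fun x y ↦ inner_tensorOp ?_ ?_ x y
    · intro x y
      rw [π.map_adj rfl, ContinuousLinearMap.star_eq_adjoint,
        ContinuousLinearMap.adjoint_inner_left]
    · intro x y
      simpa using inner_leftRegular s⁻¹ x y

/-- The representation `Π ⊗ Λ` of `C*(𝓑)` on `H ⊗ ℓ²(G)`, for a representation `Π` of `C*(𝓑)` on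
`H`: the integrated form of `b_t ↦ Π(b_t) ⊗ λ_t`. -/
noncomputable def tensorRegular (P : 𝓑.FullCStar →⋆ₙₐ[ℂ] (H →L[ℂ] H)) :
    𝓑.FullCStar →⋆ₙₐ[ℂ]
      (HilbertTensor H (EllTwoGroup G) →L[ℂ] HilbertTensor H (EllTwoGroup G)) :=
  Representation.integrated
    (D := HilbertTensor H (EllTwoGroup G) →L[ℂ] HilbertTensor H (EllTwoGroup G))
    (Representation.restrict P).tensorRegular

lemma tensorRegular_ι (P : 𝓑.FullCStar →⋆ₙₐ[ℂ] (H →L[ℂ] H)) (t : G) (b : 𝓑.fiber t) :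
    tensorRegular P (𝓑.ι.map t b) =
      tensorOp (P (𝓑.ι.map t b)) (leftRegular t).toContinuousLinearMap :=
  Representation.integrated_ι
    (D := HilbertTensor H (EllTwoGroup G) →L[ℂ] HilbertTensor H (EllTwoGroup G)) _ t b

end FellBundle

end TensorRegular

/-! ### Factoring a `*`-homomorphism through another one with smaller kernel -/

section CStarFactorization

variable {A B C : Type*} [NonUnitalCStarAlgebra A] [NonUnitalCStarAlgebra B]
  [NonUnitalCStarAlgebra C]

/-! Write π for the restriction of Π to the fibers. For a finitely supported section ξ the operator
(π ⊗ λ)(ξ) sends h ⊗ δ_s to ∑_t π(ξ_t)h ⊗ δ_{ts}, a sum of mutually orthogonal terms. Hence ⟨(π ⊗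
λ)(ξ)(h ⊗ δ_s), (π ⊗ λ)(η)(k ⊗ δ_s)⟩ = ⟨h, π(⟨ξ, η⟩)k⟩, where ⟨ξ, η⟩ ∈ B_e is the inner product of
ℓ²(𝓑) (`inner_tensorRegular`). For each s the vectors (π ⊗ λ)(ξ)(h ⊗ δ_s) therefore span a copy of
the interior tensor product of ℓ²(𝓑) and H over B_e, on which π ⊗ λ acts through the first factor,
that is, through Λ.

Existence of Π' follows from the kernel inclusion ker Λ ⊆ ker(Π ⊗ Λ). The formula gives ‖(π ⊗
λ)(cξ)(h ⊗ δ_s)‖ ≤ ‖cξ‖‖h‖ ≤ ‖Λ(c)‖‖ξ‖‖h‖. So Λ(a) = 0 forces (Π ⊗ Λ)(a) to vanish on the range of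
every (Π ⊗ Λ)(b), and b = a* gives (Π ⊗ Λ)(a) = 0 even when Π is degenerate (`integrated_eq_zero`).
A `*`-homomorphism of C⋆-algebras factors through any other with dense range and smaller kernel
(`exists_comp_eq_of_ker_le`).

For faithfulness, if π is injective on B_e then it is isometric there, so ‖cξ‖² = ‖⟨cξ, cξ⟩‖ can be
measured on vectors of H. It becomes the supremum of ‖(π ⊗ λ)(c)(π ⊗ λ)(ξ)(h ⊗ δ_s)‖² over unit
vectors h, for any one fixed s. This yields ‖Λ(c)‖ ≤ ‖(π ⊗ λ)(c)‖ (`norm_Λ_le_of_injective`), so Π'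
does not decrease norms.

The argument uses only the coefficient formula and the totality of the vectors h ⊗ δ_s;
`IsInducedFrom` isolates these two facts. It asks nothing about inner products between vectors with
different indices. -/

lemma NonUnitalStarAlgHom.continuous_of_cstar (φ : A →⋆ₙₐ[ℂ] B) : Continuous φ :=
  AddMonoidHomClass.continuous_of_bound φ 1 fun a ↦ by
    simpa using NonUnitalStarAlgHom.norm_apply_le φ a

/-- If `φ` kills only elements that `ψ` kills, then `‖ψ a‖ ≤ ‖φ a‖` for self-adjoint `a`. -/
lemma IsSelfAdjoint.norm_map_le_of_ker_le (φ : A →⋆ₙₐ[ℂ] B) (ψ : A →⋆ₙₐ[ℂ] C)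
    (h : ∀ a, φ a = 0 → ψ a = 0) {a : A} (ha : IsSelfAdjoint a) : ‖ψ a‖ ≤ ‖φ a‖ := by
  -- `f` vanishes exactly on the interval of radius `‖φ a‖` around 0, which contains the
  -- quasispectrum of `φ a`. So `φ` kills `f(a)`, hence `ψ` does too, and the quasispectrum of `ψ a`
  -- must lie in the same interval.
  let f : ℝ → ℝ := fun x ↦ max (‖x‖ - ‖φ a‖) 0
  have hf : Continuous f := by fun_prop
  have hf0 : f 0 = 0 := by simp [f]
  have hφ : IsSelfAdjoint (φ a) := ha.map φ
  have hψ : IsSelfAdjoint (ψ a) := ha.map ψ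
  have hzero : φ (cfcₙ f a) = 0 := by
    rw [NonUnitalStarAlgHomClass.map_cfcₙ (S := ℂ) φ f a hf.continuousOn hf0
      φ.continuous_of_cstar ha hφ,
      ← norm_le_zero_iff]
    refine norm_cfcₙ_le fun x hx ↦ ?_
    have := NonUnitalIsometricContinuousFunctionalCalculus.norm_quasispectrum_le (φ a) hx hφ
    simpa [f] using this
  have hzero' := h _ hzero
  rw [NonUnitalStarAlgHomClass.map_cfcₙ (S := ℂ) ψ f a hf.continuousOn hf0
    ψ.continuous_of_cstar ha hψ] at hzero'
  rw [← cfcₙ_id ℝ (ψ a) hψ]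
  refine norm_cfcₙ_le fun x hx ↦ ?_
  have := norm_apply_le_norm_cfcₙ f (ψ a) hx hf.continuousOn hf0 hψ
  rw [hzero', norm_zero, norm_le_zero_iff, max_eq_right_iff] at this
  simpa using this

/-- The C⋆-identity reduces the estimate to the self-adjoint element `star a * a`. -/
lemma NonUnitalStarAlgHom.norm_map_le_of_ker_le (φ : A →⋆ₙₐ[ℂ] B) (ψ : A →⋆ₙₐ[ℂ] C)
    (h : ∀ a, φ a = 0 → ψ a = 0) (a : A) : ‖ψ a‖ ≤ ‖φ a‖ := by
  have := (IsSelfAdjoint.star_mul_self a).norm_map_le_of_ker_le φ ψ h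
  rw [map_mul, map_mul, map_star, map_star, CStarRing.norm_star_mul_self,
    CStarRing.norm_star_mul_self] at this
  exact (mul_self_le_mul_self_iff (norm_nonneg _) (norm_nonneg _)).2 this

/-- A `*`-homomorphism `ψ` factors through a `*`-homomorphism `φ` with dense range whose kernel is
contained in that of `ψ`. -/
lemma NonUnitalStarAlgHom.exists_comp_eq_of_ker_le (φ : A →⋆ₙₐ[ℂ] B) (ψ : A →⋆ₙₐ[ℂ] C)
    (hφ : DenseRange φ) (h : ∀ a, φ a = 0 → ψ a = 0) : ∃ χ : B →⋆ₙₐ[ℂ] C, χ.comp φ = ψ := by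
  -- The norm comparison makes `φ a ↦ ψ a` well defined and contractive on the dense range of `φ`;
  -- `F` is its continuous extension. Density and the bound enter in `hF`.
  let F : B →L[ℂ] C := (ψ : A →ₗ[ℂ] C).extendOfNorm (φ : A →ₗ[ℂ] B)
  have hF : ∀ a, F (φ a) = ψ a := fun a ↦
    LinearMap.extendOfNorm_eq (f := (ψ : A →ₗ[ℂ] C)) (e := (φ : A →ₗ[ℂ] B)) hφ
      ⟨1, fun a ↦ by rw [one_mul]; exact NonUnitalStarAlgHom.norm_map_le_of_ker_le φ ψ h a⟩ a
  have hFc : Continuous F := F.continuous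
  refine ⟨{ toFun := F
            map_smul' := fun c x ↦ map_smul F c x
            map_zero' := map_zero F
            map_add' := map_add F
            map_mul' := fun x y ↦ ?_
            map_star' := fun x ↦ ?_ }, NonUnitalStarAlgHom.ext hF⟩
  · refine hφ.induction_on₂ (p := fun x y ↦ F (x * y) = F x * F y)
      (isClosed_eq (by fun_prop) (by fun_prop)) (fun a b ↦ ?_) x y
    rw [← map_mul, hF, hF, hF, map_mul]
  · refine hφ.induction_on (p := fun x ↦ F (star x) = star (F x)) x
      (isClosed_eq (by fun_prop) (by fun_prop)) fun a ↦ ?_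
    rw [← map_star, hF, hF, map_star]

end CStarFactorization

/-! ### Finitely supported sections inside ℓ²(𝓑) -/

namespace FellBundle

variable {G : Type*} [Group G] {𝓑 : FellBundle G}

lemma fiberInner_one (a b : 𝓑.UnitFiber) : 𝓑.fiberInner 1 a b = star a * b := by
  -- The adjoint in `fiberInner` lies in the fiber over `1⁻¹`; with a variable `s` in its place the
  -- equation `s = 1` can be substituted.
  have key : ∀ {s : G} (h : (1 : G)⁻¹ = s) (h' : s * 1 = 1),
      𝓑.mul h' (𝓑.adj h a) b = star a * b := fun {s} h h' ↦ by
    obtain rfl : s = 1 := by rw [← h, inv_one]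
    rfl
  exact key rfl _

open scoped Classical in
/-- The section in `ℓ²(𝓑)` with value `b` at `t` and `0` elsewhere. -/
noncomputable def EllTwo.single (t : G) : 𝓑.fiber t →ₗ[ℂ] 𝓑.EllTwo where
  toFun b := EllTwo.mk (Pi.single t b) <| summable_of_hasFiniteSupport <|
    (Set.finite_singleton t).subset fun s hs ↦ by
      by_contra hst
      exact hs (by simp [Pi.single_eq_of_ne hst])
  map_add' a b := EllTwo.val_injective (Pi.single_add t a b)
  map_smul' c b := EllTwo.val_injective (Pi.single_smul t c b)

@[simp] lemma EllTwo.val_single_self (t : G) (b : 𝓑.fiber t) :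
    EllTwo.val 𝓑 (EllTwo.single t b) t = b := by
  classical
  exact Pi.single_eq_same t b

lemma EllTwo.val_single_of_ne {s t : G} (h : s ≠ t) (b : 𝓑.fiber t) :
    EllTwo.val 𝓑 (EllTwo.single t b) s = 0 := by
  classical
  exact Pi.single_eq_of_ne h b

lemma EllTwo.inner_single_left (t : G) (b : 𝓑.fiber t) (ξ : 𝓑.EllTwo) :
    EllTwo.inner 𝓑 (EllTwo.single t b) ξ = 𝓑.fiberInner t b (EllTwo.val 𝓑 ξ t) := by
  rw [EllTwo.inner_apply, tsum_eq_single t fun s hs ↦ by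
    rw [val_single_of_ne hs, LinearMap.map_zero₂], val_single_self]

/-- The inclusion of the finitely supported sections in `ℓ²(𝓑)`. -/
noncomputable def toEllTwo : 𝓑.Sections →ₗ[ℂ] 𝓑.EllTwo := Sections.toModule 𝓑 EllTwo.single

@[simp] lemma toEllTwo_single (t : G) (b : 𝓑.fiber t) :
    toEllTwo (Sections.single 𝓑 t b) = EllTwo.single t b := Sections.toModule_single _ t b

lemma leftMul_single {r s t : G} (h : r * s = t) (a : 𝓑.fiber r) (b : 𝓑.fiber s) :
    leftMul a (EllTwo.single s b) = EllTwo.single t (𝓑.mul h a b) := by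
  subst h
  ext u
  rw [val_leftMul]
  by_cases hu : u = r * s
  · subst hu
    rw [mul_section_congr _ rfl, EllTwo.val_single_self, EllTwo.val_single_self]
  · rw [EllTwo.val_single_of_ne hu, EllTwo.val_single_of_ne, map_zero]
    rintro rfl
    exact hu (mul_inv_cancel_left r u).symm

/-- By bilinearity this need only be checked on single fibers. It turns estimates for the regular
operators on a dense subspace into statements about convolution in C_c(𝓑). -/
lemma regularRep_toEllTwo (c ξ : 𝓑.Sections) :
    Adjointable.toCLM 𝓑 (𝓑.regularRep.sectionsHom c) (toEllTwo ξ) = toEllTwo (c * ξ) := by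
  induction c using Sections.induction with
  | add c d hc hd => rw [map_add, map_add, add_mul, map_add, ← hc, ← hd]; rfl
  | single r a =>
  induction ξ using Sections.induction with
  | add ξ η hξ hη => rw [map_add, map_add, mul_add, map_add, hξ, hη]
  | single s b =>
    rw [Representation.sectionsHom_single, Sections.single_mul_single rfl, toEllTwo_single,
      toEllTwo_single]
    exact leftMul_single rfl a b

/-- The truncation ξ_F of ξ to a finite set F satisfies ⟨ξ_F, ξ_F⟩ = ⟨ξ_F, ξ⟩ = ∑_{t ∈ F} ξ_t*ξ_t.
So ‖ξ_F − ξ‖² is the norm of a tail of the series for ⟨ξ, ξ⟩, which tends to 0 along the finite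
subsets of G. -/
lemma denseRange_toEllTwo : DenseRange (toEllTwo : 𝓑.Sections → 𝓑.EllTwo) := fun ξ ↦ by
  let u : Finset G → 𝓑.Sections := fun F ↦ ∑ t ∈ F, Sections.single 𝓑 t (EllTwo.val 𝓑 ξ t)
  have hu : ∀ F, toEllTwo (u F) = ∑ t ∈ F, EllTwo.single t (EllTwo.val 𝓑 ξ t) := fun F ↦ by
    simp [u, map_sum]
  have huξ : ∀ F, EllTwo.inner 𝓑 (toEllTwo (u F)) ξ =
      ∑ t ∈ F, 𝓑.fiberInner t (EllTwo.val 𝓑 ξ t) (EllTwo.val 𝓑 ξ t) := fun F ↦ by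
    rw [hu, map_sum, LinearMap.sum_apply]
    exact Finset.sum_congr rfl fun t _ ↦ EllTwo.inner_single_left _ _ _
  have huu : ∀ F, EllTwo.inner 𝓑 (toEllTwo (u F)) (toEllTwo (u F)) =
      ∑ t ∈ F, 𝓑.fiberInner t (EllTwo.val 𝓑 ξ t) (EllTwo.val 𝓑 ξ t) := fun F ↦ by
    have hval : ∀ t ∈ F, EllTwo.val 𝓑 (toEllTwo (u F)) t = EllTwo.val 𝓑 ξ t := fun t ht ↦ by
      rw [hu, map_sum, Finset.sum_apply, Finset.sum_eq_single t
        (fun s _ hs ↦ EllTwo.val_single_of_ne hs.symm _) (fun h ↦ absurd ht h),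
        EllTwo.val_single_self]
    -- Only the left argument is expanded into single fibers; pairing with these evaluates the right
    -- argument at points of `F`, where `hval` applies.
    nth_rw 1 [hu F]
    rw [map_sum, LinearMap.sum_apply]
    exact Finset.sum_congr rfl fun t ht ↦ by rw [EllTwo.inner_single_left, hval t ht]
  have hdiff : ∀ F, EllTwo.inner 𝓑 (toEllTwo (u F) - ξ) (toEllTwo (u F) - ξ) =
      EllTwo.inner 𝓑 ξ ξ - ∑ t ∈ F, 𝓑.fiberInner t (EllTwo.val 𝓑 ξ t) (EllTwo.val 𝓑 ξ t) :=
    fun F ↦ by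
      rw [map_sub, map_sub, LinearMap.sub_apply, LinearMap.sub_apply, huu, huξ,
        ← EllTwo.star_inner (toEllTwo (u F)) ξ, huξ, star_sum]
      simp only [star_fiberInner]
      abel
  refine mem_closure_of_tendsto (f := fun F ↦ toEllTwo (u F)) (b := Filter.atTop) ?_
    (Filter.Eventually.of_forall fun F ↦ ⟨u F, rfl⟩)
  rw [tendsto_iff_norm_sub_tendsto_zero]
  simp only [EllTwo.norm_def, hdiff]
  have h0 := (((EllTwo.hasSum_inner ξ ξ).const_sub (EllTwo.inner 𝓑 ξ ξ)).norm).sqrt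
  simpa using! h0

/-! ### The dense images of C_c(𝓑) in the full and reduced algebras -/

lemma Representation.integrated_ofSections {D : Type*} [NonUnitalCStarAlgebra D]
    (π : 𝓑.Representation D) (f : 𝓑.Sections) :
    π.integrated (𝓑.ofSections f) = π.sectionsHom f :=
  CStarSeminorm.Completion.lift_ofHom 𝓑.fullSeminorm π.sectionsHom _ f

lemma denseRange_ofSections : DenseRange (𝓑.ofSections : 𝓑.Sections → 𝓑.FullCStar) :=
  CStarSeminorm.Completion.denseRange_of 𝓑.fullSeminorm

/-- Both sides are additive and agree on the fibers. Reading an element of `ReducedCStar` as an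
operator on ℓ²(𝓑) lets its norm be computed there. -/
lemma coe_Λ_ofSections (f : 𝓑.Sections) :
    (show 𝓑.reducedSubalgebra from 𝓑.Λ (𝓑.ofSections f)).1 = 𝓑.regularRep.sectionsHom f := by
  rw [Λ, Representation.integrated_ofSections]
  induction f using Sections.induction with
  | add f g hf hg =>
    rw [map_add, map_add, ← hf, ← hg]
    rfl
  | single t b =>
    rw [Representation.sectionsHom_single, Representation.sectionsHom_single]
    rfl

lemma norm_Λ_ofSections (f : 𝓑.Sections) :
    ‖𝓑.Λ (𝓑.ofSections f)‖ = ‖𝓑.regularRep.sectionsHom f‖ := by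
  rw [← coe_Λ_ofSections]
  rfl

/-- The reduced algebra is by definition the closure of this range among the adjointable operators;
what remains is to pass to the closure in the subspace topology. -/
lemma denseRange_Λ_ofSections : DenseRange fun f ↦ 𝓑.Λ (𝓑.ofSections f) := fun x ↦ by
  change 𝓑.reducedSubalgebra at x
  have hx : (x : 𝓑.Adjointable) ∈ closure (Set.range 𝓑.regularRep.sectionsHom) := x.2
  have hr : Set.range 𝓑.regularRep.sectionsHom = Subtype.val ''
      Set.range fun f ↦ (show 𝓑.reducedSubalgebra from 𝓑.Λ (𝓑.ofSections f)) := by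
    rw [← Set.range_comp]
    exact congrArg Set.range (funext fun f ↦ (coe_Λ_ofSections f).symm)
  rw [hr] at hx
  exact closure_subtype.2 hx

end FellBundle

/-! ### The total set of vectors h ⊗ δ_s in H ⊗ ℓ²(G) -/

section TensorRegular

open scoped TensorProduct

variable {G : Type*} {H : Type*} [NormedAddCommGroup H] [InnerProductSpace ℂ H]

open scoped Classical in
/-- The vector `h ⊗ δ_s` of `H ⊗ ℓ²(G)`. -/
noncomputable def tmulSingle (h : H) (s : G) : HilbertTensor H (EllTwoGroup G) :=
  (h ⊗ₜ[ℂ] (lp.single 2 s (1 : ℂ) : EllTwoGroup G) : H ⊗[ℂ] EllTwoGroup G)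

lemma inner_tmulSingle_self (h k : H) (s : G) :
    inner ℂ (tmulSingle h s) (tmulSingle k s) = inner ℂ h k := by
  simp [tmulSingle, UniformSpace.Completion.inner_coe, TensorProduct.inner_tmul]

lemma inner_tmulSingle_of_ne (h k : H) {s t : G} (hst : s ≠ t) :
    inner ℂ (tmulSingle h s) (tmulSingle k t) = 0 := by
  classical
  simp only [tmulSingle, UniformSpace.Completion.inner_coe, TensorProduct.inner_tmul,
    lp.inner_single_left, lp.coeFn_single]
  rw [Pi.single_eq_of_ne hst, inner_zero_right, mul_zero]

/-- Elementary tensors x ⊗ η are total, and for fixed x the map η ↦ x ⊗ η is continuous and linear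
(`L`). So η may be restricted to the total set of vectors δ_s. -/
lemma clm_tmulSingle_ext {T T' : HilbertTensor H (EllTwoGroup G) →L[ℂ]
    HilbertTensor H (EllTwoGroup G)} (h : ∀ x s, T (tmulSingle x s) = T' (tmulSingle x s)) :
    T = T' := by
  classical
  refine clm_hilbertTensor_ext fun x η ↦ ?_
  let L : EllTwoGroup G →L[ℂ] HilbertTensor H (EllTwoGroup G) :=
    LinearMap.mkContinuous
      ((UniformSpace.Completion.toComplₗᵢ (𝕜 := ℂ)).toLinearMap ∘ₗ TensorProduct.mk ℂ H _ x) ‖x‖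
      fun η ↦ (UniformSpace.Completion.norm_coe _).trans_le (TensorProduct.norm_tmul x η).le
  have hL : T ∘L L = T' ∘L L := by
    refine lp.ext_continuousLinearMap (ENNReal.ofNat_ne_top (n := 2)) fun s ↦ ?_
    ext
    convert h x s using 1 <;>
      simp only [L, ContinuousLinearMap.comp_apply, lp.singleContinuousLinearMap_apply,
        tmulSingle] <;> congr!
  exact congr($hL η)

variable [Group G]

lemma leftRegular_single [DecidableEq G] (t s : G) :
    leftRegular t (lp.single 2 s (1 : ℂ)) = lp.single 2 (t * s) (1 : ℂ) := by
  ext u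
  rw [leftRegular_apply, lp.coeFn_single, lp.coeFn_single]
  by_cases hu : u = t * s
  · subst hu
    simp
  · rw [Pi.single_eq_of_ne hu, Pi.single_eq_of_ne]
    rintro rfl
    exact hu (mul_inv_cancel_left t u).symm

lemma tensorOp_tmulSingle (T : H →L[ℂ] H) (t s : G) (h : H) :
    tensorOp T (leftRegular t).toContinuousLinearMap (tmulSingle h s) =
      tmulSingle (T h) (t * s) := by
  classical
  rw [tmulSingle, tensorOp_tmul, tmulSingle]
  congr 2
  exact leftRegular_single t s

/-! ### Matrix coefficients of π ⊗ λ -/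

namespace FellBundle.Representation

variable {𝓑 : FellBundle G} [CompleteSpace H] (π : 𝓑.Representation (H →L[ℂ] H))

lemma sectionsHom_tensorRegular_single (t s : G) (b : 𝓑.fiber t) (h : H) :
    π.tensorRegular.sectionsHom (Sections.single 𝓑 t b) (tmulSingle h s) =
      tmulSingle (π.map t b h) (t * s) := by
  rw [sectionsHom_single]
  exact tensorOp_tmulSingle _ _ _ _

/-- Since π(a)*π(b) = π(a*b), inner products of vectors coming from one fiber B_t depend on π only
through B_e. -/
lemma inner_map_map {t : G} (a b : 𝓑.fiber t) (h k : H) :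
    inner ℂ (π.map t a h) (π.map t b k) = inner ℂ h (π.map 1 (𝓑.fiberInner t a b) k) := by
  rw [fiberInner_apply, π.map_mul, π.map_adj, ContinuousLinearMap.star_eq_adjoint,
    mul_apply_eq_comp, ContinuousLinearMap.adjoint_inner_right]

/-- On the vectors `h ⊗ δ_s`, the representation `π ⊗ λ` is given by the inner product of
`ℓ²(𝓑)`. -/
lemma inner_tensorRegular (ξ η : 𝓑.Sections) (h k : H) (s : G) :
    inner ℂ (π.tensorRegular.sectionsHom ξ (tmulSingle h s))
        (π.tensorRegular.sectionsHom η (tmulSingle k s)) =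
      inner ℂ h (π.map 1 (EllTwo.inner 𝓑 (toEllTwo ξ) (toEllTwo η)) k) := by
  induction ξ using Sections.induction with
  | add ξ ξ' h1 h2 =>
    simp only [map_add, _root_.add_apply, LinearMap.add_apply, inner_add_left, inner_add_right,
      h1, h2]
  | single t a =>
  induction η using Sections.induction with
  | add η η' h1 h2 =>
    simp only [map_add, _root_.add_apply, inner_add_right, h1, h2]
  | single u b =>
    rw [sectionsHom_tensorRegular_single, sectionsHom_tensorRegular_single, toEllTwo_single,
      toEllTwo_single, EllTwo.inner_single_left]
    -- Distinct fibers move the same δ_s to distinct, hence orthogonal, basis vectors, just as they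
    -- are orthogonal in ℓ²(𝓑). The common `s` is what allows the right cancellation.
    by_cases htu : t = u
    · subst htu
      rw [inner_tmulSingle_self, EllTwo.val_single_self, inner_map_map]
    · rw [inner_tmulSingle_of_ne _ _ fun h ↦ htu (mul_right_cancel h),
        EllTwo.val_single_of_ne htu, map_zero, map_zero, _root_.zero_apply, inner_zero_right]

end FellBundle.Representation

end TensorRegular

/-! ### Induced representations: factorization through C*_r(𝓑) and faithfulness -/

namespace FellBundle.Representation

variable {G : Type*} [Group G] {𝓑 : FellBundle G}
  {H : Type*} [NormedAddCommGroup H] [InnerProductSpace ℂ H] [CompleteSpace H]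
  {K : Type*} [NormedAddCommGroup K] [InnerProductSpace ℂ K] [CompleteSpace K]
  {ι : Type*}

/-- The representation `ρ` on `K` has matrix coefficients on the vectors `V h i` that are induced
from `π` through the inner product of `ℓ²(𝓑)`, and the vectors `V h i` are total in `K`. -/
structure IsInducedFrom (ρ : 𝓑.Representation (K →L[ℂ] K)) (π : 𝓑.Representation (H →L[ℂ] H))
    (V : H → ι → K) : Prop where
  inner_eq : ∀ (ξ η : 𝓑.Sections) (h k : H) (i : ι),
    inner ℂ (ρ.sectionsHom ξ (V h i)) (ρ.sectionsHom η (V k i)) =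
      inner ℂ h (π.map 1 (EllTwo.inner 𝓑 (toEllTwo ξ) (toEllTwo η)) k)
  ext : ∀ T T' : K →L[ℂ] K, (∀ h i, T (V h i) = T' (V h i)) → T = T'

namespace IsInducedFrom

variable {ρ : 𝓑.Representation (K →L[ℂ] K)} {π : 𝓑.Representation (H →L[ℂ] H)} {V : H → ι → K}

/-- The squared norm on the left is ⟨h, π(⟨ξ, ξ⟩)h⟩, and π is contractive on B_e. -/
lemma norm_sectionsHom_le (hρ : ρ.IsInducedFrom π V) (ξ : 𝓑.Sections) (h : H) (i : ι) :
    ‖ρ.sectionsHom ξ (V h i)‖ ≤ ‖toEllTwo ξ‖ * ‖h‖ := by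
  have h1 : ‖ρ.sectionsHom ξ (V h i)‖ ^ 2 =
      ‖inner ℂ h (π.map 1 (EllTwo.inner 𝓑 (toEllTwo ξ) (toEllTwo ξ)) h)‖ := by
    rw [← hρ.inner_eq ξ ξ h h i, inner_self_eq_norm_sq_to_K]
    simp
  have h2 : ‖π.map 1 (EllTwo.inner 𝓑 (toEllTwo ξ) (toEllTwo ξ))‖ ≤
      ‖toEllTwo ξ‖ * ‖toEllTwo ξ‖ := by
    rw [EllTwo.norm_mul_norm]
    exact π.norm_map_le 1 _
  refine le_of_sq_le_sq ?_ (by positivity)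
  rw [h1]
  calc _ ≤ ‖h‖ * ‖π.map 1 (EllTwo.inner 𝓑 (toEllTwo ξ) (toEllTwo ξ)) h‖ := norm_inner_le_norm _ _
    _ ≤ ‖h‖ * ((‖toEllTwo ξ‖ * ‖toEllTwo ξ‖) * ‖h‖) := by
        gcongr
        exact (π.map 1 _).le_of_opNorm_le h2 h
    _ = (‖toEllTwo ξ‖ * ‖h‖) ^ 2 := by ring

/-- For `a` in C_c(𝓑), say `a = c`, this is the preceding bound for the section `c * ξ`, which is
the image of ξ under the regular operator of `c`; the general case follows by density. The estimate
concerns one vector `V h i` at a time and does not control sums of them, so it serves to compare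
kernels, not yet operator norms. -/
lemma norm_integrated_le (hρ : ρ.IsInducedFrom π V) (a : 𝓑.FullCStar) (ξ : 𝓑.Sections)
    (h : H) (i : ι) :
    ‖ρ.integrated a (ρ.sectionsHom ξ (V h i))‖ ≤
      ‖𝓑.Λ a‖ * (‖toEllTwo ξ‖ * ‖h‖) := by
  have hc := ρ.integrated.continuous_of_cstar
  have hΛ := 𝓑.Λ.continuous_of_cstar
  refine denseRange_ofSections.induction_on a
    (isClosed_le (hc.clm_apply continuous_const).norm (hΛ.norm.mul continuous_const)) fun c ↦ ?_
  rw [integrated_ofSections, norm_Λ_ofSections, ← mul_apply_eq_comp, ← _root_.map_mul, ← mul_assoc]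
  refine (hρ.norm_sectionsHom_le (c * ξ) h i).trans ?_
  gcongr
  rw [← regularRep_toEllTwo]
  exact (Adjointable.toCLM 𝓑 (𝓑.regularRep.sectionsHom c)).le_opNorm (toEllTwo ξ)

/-- The bound controls ρ(a) only on vectors ρ(ξ)(V h i), which need not be total when π is
degenerate. So one first shows ρ(a)ρ(b) = 0 for all b, using totality of the vectors `V h i`, and
then takes b = a*. -/
lemma integrated_eq_zero (hρ : ρ.IsInducedFrom π V) {a : 𝓑.FullCStar} (ha : 𝓑.Λ a = 0) :
    ρ.integrated a = 0 := by
  have hc := ρ.integrated.continuous_of_cstar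
  have h : ∀ b : 𝓑.FullCStar, ρ.integrated a * ρ.integrated b = 0 :=
    fun b ↦ denseRange_ofSections.induction_on b
      (isClosed_eq (continuous_const.mul hc) continuous_const) fun ξ ↦
        hρ.ext _ _ fun x i ↦ by
          have := hρ.norm_integrated_le a ξ x i
          rw [ha, norm_zero, zero_mul, norm_le_zero_iff] at this
          rw [integrated_ofSections, mul_apply_eq_comp, this, _root_.zero_apply]
  have := h (star a)
  rwa [map_star, CStarRing.mul_star_self_eq_zero_iff] at this

/-- If `π` is faithful on the unit fiber, then `ρ` does not decrease the reduced norm. -/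
lemma norm_Λ_le_of_injective [hι : Nonempty ι] (hρ : ρ.IsInducedFrom π V)
    (hπ : Function.Injective (π.map 1)) (c : 𝓑.Sections) :
    ‖𝓑.Λ (𝓑.ofSections c)‖ ≤ ‖ρ.sectionsHom c‖ := by
  obtain ⟨i⟩ := hι
  rw [norm_Λ_ofSections]
  refine (Adjointable.toCLM 𝓑 (𝓑.regularRep.sectionsHom c)).opNorm_le_bound (norm_nonneg _) ?_
  refine fun η ↦ denseRange_toEllTwo.induction_on η
    (isClosed_le (by fun_prop) (by fun_prop)) fun ξ ↦ ?_
  rw [regularRep_toEllTwo]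
  -- Writing ⟨cξ, cξ⟩ = d*d turns the norm of cξ into ‖d‖ and the form ⟨h, π(⟨cξ, cξ⟩)h⟩ into
  -- ‖π(d)h‖².
  obtain ⟨d, hd⟩ := CStarAlgebra.nonneg_iff_eq_star_mul_self.1
    (EllTwo.inner_self_nonneg (toEllTwo (c * ξ)))
  have hnorm : ‖toEllTwo (c * ξ)‖ = ‖d‖ := by
    rw [EllTwo.norm_def, hd, CStarRing.norm_star_mul_self, Real.sqrt_mul_self (norm_nonneg _)]
  -- Injectivity enters here: an injective `*`-homomorphism of C⋆-algebras is isometric, so ‖d‖ can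
  -- be tested on vectors of H.
  have hiso : ‖π.map 1 d‖ = ‖d‖ := NonUnitalStarAlgHom.norm_map π.unitFiberHom hπ d
  rw [hnorm, ← hiso]
  refine (π.map 1 d).opNorm_le_bound (by positivity) fun h ↦ ?_
  have hinner : inner ℂ (π.map 1 d h) (π.map 1 d h) =
      inner ℂ (ρ.sectionsHom (c * ξ) (V h i))
        (ρ.sectionsHom (c * ξ) (V h i)) := by
    rw [hρ.inner_eq, hd, inner_map_map, fiberInner_one]
  rw [@norm_eq_sqrt_re_inner ℂ, hinner, ← @norm_eq_sqrt_re_inner ℂ, _root_.map_mul, mul_apply_eq_comp,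
    mul_assoc]
  exact (ContinuousLinearMap.le_opNorm _ _).trans
    (by gcongr; exact hρ.norm_sectionsHom_le ξ h i)

/-- A representation induced from `π` factors through `C*_r(𝓑)`, faithfully so if `π` is faithful on
the unit fiber. -/
theorem exists_comp_Λ_eq [Nonempty ι] (hρ : ρ.IsInducedFrom π V) :
    ∃ P' : 𝓑.ReducedCStar →⋆ₙₐ[ℂ] (K →L[ℂ] K), P'.comp 𝓑.Λ = ρ.integrated ∧
      (Function.Injective (π.map 1) → Function.Injective P') := by
  have hΛ : DenseRange 𝓑.Λ := denseRange_Λ_ofSections.mono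
    (Set.range_comp_subset_range 𝓑.ofSections 𝓑.Λ)
  obtain ⟨P', hP'⟩ := NonUnitalStarAlgHom.exists_comp_eq_of_ker_le 𝓑.Λ ρ.integrated hΛ
    fun a ha ↦ hρ.integrated_eq_zero ha
  refine ⟨P', hP', fun hinj ↦ (injective_iff_map_eq_zero P').2 fun x hx ↦ ?_⟩
  -- Injectivity on a dense subalgebra would not pass to the closure, but this lower bound is a
  -- closed condition, so it suffices to check it on the image of C_c(𝓑).
  have hle : ‖x‖ ≤ ‖P' x‖ := denseRange_Λ_ofSections.induction_on x
    (isClosed_le continuous_norm P'.continuous_of_cstar.norm) fun c ↦ by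
      have h := congr($hP' (𝓑.ofSections c))
      rw [NonUnitalStarAlgHom.comp_apply, integrated_ofSections] at h
      rw [h]
      exact hρ.norm_Λ_le_of_injective hinj c
  rwa [hx, norm_zero, norm_le_zero_iff] at hle

end IsInducedFrom

end FellBundle.Representation

theorem theorem3p4 {G : Type*} [Group G] (𝓑 : FellBundle G)
    {H : Type*} [NormedAddCommGroup H] [InnerProductSpace ℂ H] [CompleteSpace H]
    (P : 𝓑.FullCStar →⋆ₙₐ[ℂ] (H →L[ℂ] H)) :
    ∃ P' : 𝓑.ReducedCStar →⋆ₙₐ[ℂ]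
        (HilbertTensor H (EllTwoGroup G) →L[ℂ] HilbertTensor H (EllTwoGroup G)),
      P'.comp 𝓑.Λ = FellBundle.tensorRegular P ∧
      ((Function.Injective fun b : 𝓑.UnitFiber ↦ P (𝓑.ι.map 1 b)) → Function.Injective P') := by
  -- `tensorRegular P` is by definition the integrated form of π ⊗ λ for the restriction π of `P` to
  -- the fibers, and the hypothesis on `P` is injectivity of π on B_e. The index set is G, which is
  -- nonempty.
  exact FellBundle.Representation.IsInducedFrom.exists_comp_Λ_eq
    (K := HilbertTensor H (EllTwoGroup G)) (V := tmulSingle)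
    ⟨(FellBundle.Representation.restrict P).inner_tensorRegular,
      fun _ _ ↦ clm_tmulSingle_ext⟩
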